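/- **Setting.** Let $\mathcal E$ be a finite collection of oriented arcs $\gamma:[0,1]\to\mathbb R^N$, each $C^1$ on $[0,1]$ (with one-sided derivatives at the endpoints) with non-vanishing derivative, and injective on $[0,1]$ (simple and not a loop). Assume that with $\gamma$ also the inverse arc $\tilde\gamma(s)=\gamma(1-s)$ belongs to $\mathcal E$ and that $\gamma((0,1))\cap\gamma'([0,1])=\emptyset$ whenever $\gamma'\neq\gamma,\tilde\gamma$. Let $\Gamma=\bigcup_{\gamma\in\mathcal E}\gamma([0,1])$, let $\mathbf V$ be the set of endpoints of arcs (vertices), and assume that any two vertices are linked by a finite concatenation of arcs. Curves are absolutely continuous, and $d_\Gamma(y,x)$ is the geodesic distance, i.e. the infimum of the Euclidean lengths of the curves in $\Gamma$ from $y$ to $x$. For every $\gamma\in\mathcal E$ let $H_\gamma:[0,1]\times\mathbb R\to\mathbb R$ satisfy $H_{\tilde\gamma}(s,\mu)=H_\gamma(1-s,-\mu)$ and be continuous, convex in $\mu$, strictly quasiconvex in $\mu$ (i.e. $H_\gamma(s,\rho\mu+(1-\rho)\mu')<\max\{H_\gamma(s,\mu),H_\gamma(s,\mu')\}$ for $\mu\ne\mu'$,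 $\rho\in(0,1)$), with $\lim_{|\mu|\to\infty}\inf_{s\in[0,1]}H_\gamma(s,\mu)/|\mu|=+\infty$. Put $a_\gamma=\max_{s\in[0,1]}\min_{\mu\in\mathbb R}H_\gamma(s,\mu)$ and $L_\gamma(s,\lambda)=\sup_{\mu\in\mathbb R}(\lambda\mu-H_\gamma(s,\mu))$. Let $(c_x)_{x\in\mathbf V}$ be a flux limiter: real numbers with $c_x\ge a_\gamma$ for all $x\in\mathbf V$ and all $\gamma\in\mathcal E$ with $\gamma(1)=x$. For $x\in\Gamma$ and $q\in\mathbb R^N$ tangent to $\Gamma$ at $x$ (i.e. $q=\lambda\dot\gamma(s)$ for some $\lambda\in\mathbb R$, $\gamma\in\mathcal E$, $s\in[0,1]$ with $\gamma(s)=x$), set - $L(x,q)=L_\gamma\big(s,\tfrac{q\cdot\dot\gamma(s)}{|\dot\gamma(s)|^2}\big)$ if $x=\gamma(s)$ with $s\in(0,1)$; - $L(x,q)=\min L_\gamma\big(1,\tfrac{q\cdot\dot\gamma(1)}{|\dot\gamma(1)|^2}\big)$ if $x\in\mathbf V$, $q\neq0$, the minimum being over the $\gamma\in\mathcal E$ with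 $\gamma(1)=x$ and $\dot\gamma(1)$ parallel to $q$; - $L(x,0)=-c_x$ if $x\in\mathbf V$. For $y,x\in\Gamma$ and $T\ge0$ let the minimal action be $$h_T(y,x)=\min\Big\{\int_0^TL(\xi,\dot\xi)\,d\tau:\ \xi:[0,T]\to\Gamma\text{ is a curve with }\xi(0)=y,\ \xi(T)=x\Big\}.$$ **Proposition.** Let $C>0$ and $A_C=\{(y,x,T)\in\Gamma\times\Gamma\times[0,\infty): d_\Gamma(y,x)\le CT\}$. Then for every $(y,x,T)\in A_C$ the above minimum exists and is finite, and $h$ is Lipschitz continuous on $A_C$: there is a constant $\ell$ such that $$|h_T(y,x)-h_{T'}(y',x')|\le\ell\,\big(d_\Gamma(y,y')+d_\Gamma(x,x')+|T-T'|\big)\qquad\text{for all }(y,x,T),(y',x',T')\in A_C.$$ -/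

import Mathlib

open Set Filter Topology MeasureTheory
open scoped RealInnerProductSpace

noncomputable section

/-- A connected embedded network without loops in `ℝ^N`, with oriented arcs indexed by `ι`.
The maps `arc e` matter only on `[0,1]`; one-sided derivatives are meant at `0` and `1`. -/
structure EmbeddedNetwork (N : ℕ) (ι : Type*) where
  finite : Finite ι
  /-- the arcs, parametrized on `[0,1]` -/
  arc : ι → ℝ → EuclideanSpace ℝ (Fin N)
  /-- the index of the inverse arc -/
  rev : ι → ι
  arc_rev : ∀ e, ∀ s ∈ Icc (0 : ℝ) 1, arc (rev e) s = arc e (1 - s)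
  contDiffOn_arc : ∀ e, ContDiffOn ℝ 1 (arc e) (Icc 0 1)
  derivWithin_arc_ne_zero : ∀ e, ∀ s ∈ Icc (0 : ℝ) 1, derivWithin (arc e) (Icc 0 1) s ≠ 0
  /-- the arcs are simple and are not loops -/
  injOn_arc : ∀ e, InjOn (arc e) (Icc 0 1)
  /-- different arcs which are not inverse to each other can only meet at their endpoints -/
  disjoint_arc : ∀ e e', e' ≠ e → e' ≠ rev e →
    Disjoint (arc e '' Ioo 0 1) (arc e' '' Icc 0 1)
  /-- two vertices are linked by a finite concatenation of arcs -/
  connected : ∀ x ∈ range (fun e => arc e 0) ∪ range (fun e => arc e 1),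
    ∀ y ∈ range (fun e => arc e 0) ∪ range (fun e => arc e 1),
      Relation.ReflTransGen (fun z w => ∃ e, arc e 0 = z ∧ arc e 1 = w) x y

namespace EmbeddedNetwork

variable {N : ℕ} {ι : Type*} (Γ : EmbeddedNetwork N ι)

/-- The support of the network. -/
def carrier : Set (EuclideanSpace ℝ (Fin N)) := ⋃ e, Γ.arc e '' Icc 0 1

/-- The vertices: initial and terminal points of the arcs. -/
def vertices : Set (EuclideanSpace ℝ (Fin N)) :=
  range (fun e => Γ.arc e 0) ∪ range (fun e => Γ.arc e 1)

/-- The derivative of the arc `e` at `s ∈ [0,1]` (one-sided at the endpoints). -/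
def tangent (e : ι) (s : ℝ) : EuclideanSpace ℝ (Fin N) := derivWithin (Γ.arc e) (Icc 0 1) s

/-- The coordinate of `q` along the arc `e` at `s`, namely `q · γ'(s) / |γ'(s)|²`. -/
def coord (e : ι) (s : ℝ) (q : EuclideanSpace ℝ (Fin N)) : ℝ :=
  ⟪q, Γ.tangent e s⟫ / ‖Γ.tangent e s‖ ^ 2

/-- `ξ` restricted to `[0,T]` is an absolutely continuous curve in the network from `y` to `x`. -/
structure IsCurve (T : ℝ) (ξ : ℝ → EuclideanSpace ℝ (Fin N))
    (y x : EuclideanSpace ℝ (Fin N)) : Prop where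
  absolutelyContinuous : AbsolutelyContinuousOnInterval ξ 0 T
  mapsTo : MapsTo ξ (Icc 0 T) Γ.carrier
  source : ξ 0 = y
  target : ξ T = x

/-- The geodesic distance: the infimum of the Euclidean lengths of the curves in the network
from `y` to `x` (a finite quantity for points of the network, which is connected). -/
def geodesicDist (y x : EuclideanSpace ℝ (Fin N)) : ℝ :=
  (⨅ (ξ : ℝ → EuclideanSpace ℝ (Fin N)) (_ : Γ.IsCurve 1 ξ y x),
    eVariationOn ξ (Icc 0 1)).toReal

/-- The set of the `(y, x, T) ∈ Γ × Γ × [0,∞)` with `d_Γ(y,x) ≤ C T`. -/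
def reachable (C : ℝ) :
    Set (EuclideanSpace ℝ (Fin N) × EuclideanSpace ℝ (Fin N) × ℝ) :=
  {p | p.1 ∈ Γ.carrier ∧ p.2.1 ∈ Γ.carrier ∧ 0 ≤ p.2.2 ∧
    Γ.geodesicDist p.1 p.2.1 ≤ C * p.2.2}

/-- A Hamiltonian on the network: a family of functions `H_γ(s,μ)`, `s ∈ [0,1]`, `μ ∈ ℝ`, which
are continuous, uniformly superlinear, convex and strictly quasiconvex in `μ`. -/
structure Hamiltonian where
  toFun : ι → ℝ → ℝ → ℝ
  rev_eq : ∀ e, ∀ s ∈ Icc (0 : ℝ) 1, ∀ μ, toFun (Γ.rev e) s μ = toFun e (1 - s) (-μ)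
  continuousOn : ∀ e, ContinuousOn (fun p : ℝ × ℝ => toFun e p.1 p.2) (Icc 0 1 ×ˢ univ)
  superlinear : ∀ e,
    Tendsto (fun μ : ℝ => ⨅ s : Icc (0 : ℝ) 1, toFun e s μ / |μ|) (cocompact ℝ) atTop
  convexOn : ∀ e, ∀ s ∈ Icc (0 : ℝ) 1, ConvexOn ℝ univ (toFun e s)
  strictQuasiconvex : ∀ e, ∀ s ∈ Icc (0 : ℝ) 1, ∀ μ μ' : ℝ, μ ≠ μ' → ∀ ρ ∈ Ioo (0 : ℝ) 1,
    toFun e s (ρ * μ + (1 - ρ) * μ') < max (toFun e s μ) (toFun e s μ')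

namespace Hamiltonian

variable {Γ} (H : Γ.Hamiltonian)

/-- `a_γ = max_{s ∈ [0,1]} min_{μ ∈ ℝ} H_γ(s,μ)`. -/
def arcLevel (e : ι) : ℝ := ⨆ s : Icc (0 : ℝ) 1, ⨅ μ : ℝ, H.toFun e s μ

/-- `L_γ(s,v) = sup_{μ ∈ ℝ} (v μ - H_γ(s,μ))`. -/
def arcLagrangian (e : ι) (s v : ℝ) : ℝ := ⨆ μ : ℝ, (v * μ - H.toFun e s μ)

/-- A flux limiter: constants `c_x ≥ max {a_γ : γ(1) = x}` at the vertices `x`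
(only the values of `c` at the vertices matter). -/
def IsFluxLimiter (c : EuclideanSpace ℝ (Fin N) → ℝ) : Prop :=
  ∀ x ∈ Γ.vertices, ∀ e, Γ.arc e 1 = x → H.arcLevel e ≤ c x

open scoped Classical in
/-- The Lagrangian on the tangent bundle of the network (only its values there matter). At a vertex
`x` and for `q ≠ 0` it is the minimum over the arcs ending at `x` with tangent parallel to `q`.
At `x = γ(s)`, `0 < s < 1`, only `γ` and its inverse arc pass through `x`, and both give the same
value, so that the last set is a singleton. -/
def lagrangian (c : EuclideanSpace ℝ (Fin N) → ℝ) (x q : EuclideanSpace ℝ (Fin N)) : ℝ :=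
  if x ∈ Γ.vertices then
    if q = 0 then -c x
    else sInf {l | ∃ e, Γ.arc e 1 = x ∧ (∃ k : ℝ, q = k • Γ.tangent e 1) ∧
      l = H.arcLagrangian e 1 (Γ.coord e 1 q)}
  else sInf {l | ∃ e, ∃ s ∈ Ioo (0 : ℝ) 1, Γ.arc e s = x ∧
      l = H.arcLagrangian e s (Γ.coord e s q)}

/-- The finite actions `∫_0^T L(ξ,ξ') dτ` of the curves `ξ : [0,T] → Γ` from `y` to `x`. As `L` is
bounded from below on the tangent bundle, a curve that is left out here has action `+∞`. -/
def actions (c : EuclideanSpace ℝ (Fin N) → ℝ) (y x : EuclideanSpace ℝ (Fin N)) (T : ℝ) : Set ℝ :=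
  {A | ∃ ξ : ℝ → EuclideanSpace ℝ (Fin N), Γ.IsCurve T ξ y x ∧
    IntervalIntegrable (fun t => H.lagrangian c (ξ t) (deriv ξ t)) volume 0 T ∧
    A = ∫ t in (0 : ℝ)..T, H.lagrangian c (ξ t) (deriv ξ t)}

/-- The minimal action `h_T(y,x)`. -/
def minAction (c : EuclideanSpace ℝ (Fin N) → ℝ) (y x : EuclideanSpace ℝ (Fin N)) (T : ℝ) : ℝ :=
  sInf (H.actions c y x T)

end Hamiltonian

end EmbeddedNetwork

end

/-! Existence is the direct method, carried out without weak convergence of derivatives. Along a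
minimizing sequence one records both the curves and their running actions, made nondecreasing by
adding a multiple of time, and takes pointwise limits of both along an ultrafilter. Superlinearity
of the Lagrangian bounds `R * dist` by an increment of the running action plus `M_R` times the
elapsed time, for every `R`. This survives in the limit and makes the limit curve absolutely
continuous (`of_modulus`). It remains to bound the Lagrangian of the limit curve a.e. by the
derivative of the limit running action, because the integral of the derivative of a monotone
function is at most its increment.

That pointwise bound comes from lower bounds of the action of short curves by their endpoints
(`HasLocalBound`), which pass to pointwise limits. Inside an arc, Fenchel's inequality with a fixed
covector gives one for each slope, and the supremum over slopes recovers the Lagrangian. At a vertex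
`x` the velocity vanishes a.e., and only the rate `-c x` has to be recovered. The inequality `c x ≥
a_γ` yields a covector on each arc ending at `x` whose Hamiltonian is below `c x + ε`, and these
linear functions glue to a function vanishing at `x` (`exists_hasLocalBound_vertex`).

For the Lipschitz estimate, let `δ` be the sum of the three distances. On the reachable set the
minimal action lies between multiples of `T`, so the case `T ≤ 8δ` is immediate. Otherwise a
minimizer is shortened in time by `2δ` at a cost proportional to `δ` (`exists_action_sub_le`), and
the time saved pays for connecting the endpoints at bounded speed. The shortening accelerates the
curve only when it is slow, so no regularity of minimizers is needed. -/

/-! ### Real analysis: absolutely continuous curves, monotone functions, level sets. -/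

open AbsolutelyContinuousOnInterval in
theorem AbsolutelyContinuousOnInterval.of_dist_le {X Y : Type*} [PseudoMetricSpace X]
    [PseudoMetricSpace Y] {f : ℝ → X} {g : ℝ → Y} {a b : ℝ}
    (hg : AbsolutelyContinuousOnInterval g a b)
    (h : ∀ s ∈ uIcc a b, ∀ t ∈ uIcc a b, dist (f s) (f t) ≤ dist (g s) (g t)) :
    AbsolutelyContinuousOnInterval f a b := by
  rw [absolutelyContinuousOnInterval_iff] at hg ⊢
  intro ε hε
  obtain ⟨δ, hδ, H⟩ := hg ε hε
  refine ⟨δ, hδ, fun I hI hs => lt_of_le_of_lt (Finset.sum_le_sum fun i hi => ?_) (H I hI hs)⟩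
  exact h _ (hI.1 i hi).1 _ (hI.1 i hi).2

namespace AbsolutelyContinuousOnInterval

/-- Disjointness of half-open intervals is an inequality between a minimum of right ends and a
maximum of left ends, which monotone maps preserve. No continuity or injectivity is needed. -/
theorem map_mem_disjWithin {φ : ℝ → ℝ} {a b c d : ℝ} (hφ : MonotoneOn φ (uIcc a b))
    (hm : MapsTo φ (uIcc a b) (uIcc c d)) {n : ℕ} {I : ℕ → ℝ × ℝ} (hI : (n, I) ∈ disjWithin a b) :
    (n, fun i => (φ (I i).1, φ (I i).2)) ∈ disjWithin c d := by
  refine ⟨fun i hi => ⟨hm (hI.1 i hi).1, hm (hI.1 i hi).2⟩, fun i hi j hj hij => ?_⟩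
  have h := hI.2 hi hj hij
  obtain ⟨hi1, hi2⟩ := hI.1 i hi
  obtain ⟨hj1, hj2⟩ := hI.1 j hj
  simp only [Function.onFun, uIoc, Ioc_disjoint_Ioc] at h ⊢
  have mx : ∀ x ∈ uIcc a b, ∀ y ∈ uIcc a b, max x y ∈ uIcc a b := fun x hx y hy => by
    rcases max_choice x y with h | h <;> rw [h] <;> assumption
  have mn : ∀ x ∈ uIcc a b, ∀ y ∈ uIcc a b, min x y ∈ uIcc a b := fun x hx y hy => by
    rcases min_choice x y with h | h <;> rw [h] <;> assumption
  rw [← hφ.map_max hi1 hi2, ← hφ.map_max hj1 hj2, ← hφ.map_min hi1 hi2, ← hφ.map_min hj1 hj2,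
    ← hφ.map_min (mx _ hi1 _ hi2) (mx _ hj1 _ hj2), ← hφ.map_max (mn _ hi1 _ hi2) (mn _ hj1 _ hj2)]
  exact hφ (mn _ (mx _ hi1 _ hi2) _ (mx _ hj1 _ hj2)) (mx _ (mn _ hi1 _ hi2) _ (mn _ hj1 _ hj2)) h

theorem sum_dist_le {a b : ℝ} (hab : a ≤ b) {n : ℕ} {I : ℕ → ℝ × ℝ}
    (hI : (n, I) ∈ disjWithin a b) :
    ∑ i ∈ Finset.range n, dist (I i).1 (I i).2 ≤ b - a := by
  have h1 : volume (⋃ i ∈ Finset.range n, uIoc (I i).1 (I i).2) ≤ volume (uIoc a b) :=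
    measure_mono (biUnion_uIoc_subset_of_mem_disjWithin hI)
  rw [measure_biUnion_finset hI.2 (fun i _ => measurableSet_uIoc), uIoc_of_le hab,
    Real.volume_Ioc] at h1
  have h2 : ∀ i, volume (uIoc (I i).1 (I i).2) = ENNReal.ofReal (dist (I i).1 (I i).2) := fun i => by
    simp [uIoc, Real.dist_eq, max_sub_min_eq_abs']
  simp only [h2] at h1
  rw [← ENNReal.ofReal_sum_of_nonneg (fun _ _ => dist_nonneg)] at h1
  exact (ENNReal.ofReal_le_ofReal_iff (by linarith)).1 h1

theorem comp_monotoneOn {X : Type*} [PseudoMetricSpace X] {f : ℝ → X} {φ : ℝ → ℝ} {a b c d : ℝ}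
    (hf : AbsolutelyContinuousOnInterval f c d) (hφ : MonotoneOn φ (uIcc a b))
    (hm : MapsTo φ (uIcc a b) (uIcc c d)) (hac : AbsolutelyContinuousOnInterval φ a b) :
    AbsolutelyContinuousOnInterval (fun t => f (φ t)) a b := by
  rw [absolutelyContinuousOnInterval_iff] at hf hac ⊢
  intro ε hε
  obtain ⟨δ, hδ, H⟩ := hf ε hε
  obtain ⟨η, hη, H'⟩ := hac δ hδ
  exact ⟨η, hη, fun ⟨n, I⟩ hI hs => H _ (map_mem_disjWithin hφ hm hI) (H' _ hI hs)⟩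

/-- The increments of `a` over disjoint intervals add up to at most `a T - a 0`, and division by a
large `R` makes their contribution small even if `a` jumps. This form of equi-integrability is
stable under pointwise limits. -/
theorem of_modulus {X : Type*} [PseudoMetricSpace X] {f : ℝ → X} {a : ℝ → ℝ} {T : ℝ} (hT : 0 ≤ T)
    (ha : MonotoneOn a (Icc 0 T))
    (h : ∀ R > (0 : ℝ), ∃ M : ℝ, ∀ s ∈ Icc 0 T, ∀ t ∈ Icc 0 T, s ≤ t →
      R * dist (f s) (f t) ≤ a t - a s + M * (t - s)) :
    AbsolutelyContinuousOnInterval f 0 T := by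
  rw [absolutelyContinuousOnInterval_iff]
  intro ε hε
  have h0 : a 0 ≤ a T := ha (by simp [hT]) (by simp [hT]) hT
  have hR : 0 < (a T - a 0 + 1) / ε := div_pos (by linarith) hε
  obtain ⟨M, hM⟩ := h _ hR
  refine ⟨1 / (|M| + 1), by positivity, fun ⟨n, I⟩ hI hs => ?_⟩
  simp only at hs ⊢
  have hmaps : MapsTo a (uIcc 0 T) (uIcc (a 0) (a T)) := by
    rw [uIcc_of_le hT, uIcc_of_le h0]
    exact fun t ht => ⟨ha (by simp [hT]) ht ht.1, ha ht (by simp [hT]) ht.2⟩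
  have h1 := sum_dist_le h0 (map_mem_disjWithin (by rwa [uIcc_of_le hT]) hmaps hI)
  simp only at h1
  have h2 : ∀ i ∈ Finset.range n, (a T - a 0 + 1) / ε * dist (f (I i).1) (f (I i).2) ≤
      dist (a (I i).1) (a (I i).2) + |M| * dist (I i).1 (I i).2 := by
    intro i hi
    obtain ⟨hi1, hi2⟩ := hI.1 i hi
    rw [uIcc_of_le hT] at hi1 hi2
    rcases le_total (I i).1 (I i).2 with hle | hle
    · refine (hM _ hi1 _ hi2 hle).trans (add_le_add ?_ ?_)
      · rw [dist_comm]; exact le_abs_self _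
      · rw [dist_comm, Real.dist_eq, abs_of_nonneg (sub_nonneg.2 hle)]
        exact mul_le_mul_of_nonneg_right (le_abs_self _) (sub_nonneg.2 hle)
    · rw [dist_comm (f _)]
      refine (hM _ hi2 _ hi1 hle).trans (add_le_add ?_ ?_)
      · exact le_abs_self _
      · rw [Real.dist_eq, abs_of_nonneg (sub_nonneg.2 hle)]
        exact mul_le_mul_of_nonneg_right (le_abs_self _) (sub_nonneg.2 hle)
  have h3 := Finset.sum_le_sum h2
  rw [← Finset.mul_sum, Finset.sum_add_distrib, ← Finset.mul_sum] at h3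
  have h4 : |M| * ∑ i ∈ Finset.range n, dist (I i).1 (I i).2 < 1 := by
    calc |M| * ∑ i ∈ Finset.range n, dist (I i).1 (I i).2 ≤ |M| * (1 / (|M| + 1)) :=
          mul_le_mul_of_nonneg_left hs.le (abs_nonneg _)
      _ < 1 := by
          rw [mul_one_div, div_lt_one (by positivity)]; linarith
  have h5 : (a T - a 0 + 1) / ε * ∑ i ∈ Finset.range n, dist (f (I i).1) (f (I i).2) <
      (a T - a 0 + 1) / ε * ε := by
    rw [div_mul_cancel₀ _ hε.ne']; linarith
  exact lt_of_mul_lt_mul_left h5 hR.le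

section Euclidean

variable {N : ℕ} {f : ℝ → EuclideanSpace ℝ (Fin N)} {a b : ℝ}

theorem inner_left (hf : AbsolutelyContinuousOnInterval f a b) (p : EuclideanSpace ℝ (Fin N)) :
    AbsolutelyContinuousOnInterval (fun t => ⟪p, f t⟫) a b := by
  refine of_dist_le (hf.const_smul ‖p‖) fun s _ t _ => ?_
  rw [Real.dist_eq, ← inner_sub_right, dist_eq_norm, ← smul_sub, norm_smul, norm_norm]
  exact abs_real_inner_le_norm _ _

theorem ae_hasDerivAt (hf : AbsolutelyContinuousOnInterval f a b) :
    ∀ᵐ t, t ∈ uIcc a b → HasDerivAt f (deriv f t) t := by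
  have h : ∀ i : Fin N, ∀ᵐ t, t ∈ uIcc a b → DifferentiableAt ℝ (fun t => f t i) t := fun i => by
    refine (of_dist_le hf fun s _ t _ => ?_ :
      AbsolutelyContinuousOnInterval (fun t => f t i) a b).ae_differentiableAt
    rw [Real.dist_eq, dist_eq_norm]
    exact PiLp.norm_apply_le (f s - f t) i
  filter_upwards [ae_all_iff.2 h] with t ht htm
  exact (differentiableAt_euclidean.2 fun i => ht i htm).hasDerivAt

theorem intervalIntegrable_norm_deriv (hf : AbsolutelyContinuousOnInterval f a b) :
    IntervalIntegrable (fun t => ‖deriv f t‖) volume a b := by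
  have h : ∀ i : Fin N, IntervalIntegrable (fun t => |deriv (fun t => f t i) t|) volume a b :=
    fun i => by
      refine (of_dist_le hf fun s _ t _ => ?_ :
        AbsolutelyContinuousOnInterval (fun t => f t i) a b).intervalIntegrable_deriv.abs
      rw [Real.dist_eq, dist_eq_norm]
      exact PiLp.norm_apply_le (f s - f t) i
  have hsum : IntervalIntegrable (fun t => ∑ i : Fin N, |deriv (fun t => f t i) t|) volume a b := by
    have := IntervalIntegrable.sum (Finset.univ : Finset (Fin N)) (fun i _ => h i)
    simpa [Finset.sum_fn] using this
  refine hsum.mono_fun (measurable_deriv f).norm.aestronglyMeasurable ?_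
  rw [EventuallyLE, ae_restrict_iff' measurableSet_uIoc]
  filter_upwards [hf.ae_hasDerivAt] with t ht htm
  have hd := ht (uIoc_subset_uIcc htm)
  have hi : ∀ i, deriv (fun t => f t i) t = deriv f t i := fun i =>
    ((EuclideanSpace.proj (𝕜 := ℝ) i).hasFDerivAt.comp_hasDerivAt t hd).deriv
  rw [norm_norm]
  refine le_trans ?_ (le_abs_self _)
  simp only [hi]
  rw [EuclideanSpace.norm_eq]
  refine (Real.sqrt_le_left (Finset.sum_nonneg fun i _ => abs_nonneg _)).2 ?_
  exact Finset.sum_sq_le_sq_sum_of_nonneg fun i _ => abs_nonneg _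

theorem integral_inner_deriv (hf : AbsolutelyContinuousOnInterval f a b)
    (p : EuclideanSpace ℝ (Fin N)) :
    ∫ t in a..b, ⟪p, deriv f t⟫ = ⟪p, f b - f a⟫ := by
  rw [inner_sub_right, ← (hf.inner_left p).integral_deriv_eq_sub]
  refine intervalIntegral.integral_congr_ae ?_
  filter_upwards [hf.ae_hasDerivAt] with t ht htm
  have := (hasDerivAt_const t p).inner ℝ (ht (uIoc_subset_uIcc htm))
  rw [this.deriv]; simp

theorem dist_le_integral (hab : a ≤ b) (hf : AbsolutelyContinuousOnInterval f a b) :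
    dist (f a) (f b) ≤ ∫ t in a..b, ‖deriv f t‖ := by
  rw [dist_comm, dist_eq_norm]
  rcases (norm_nonneg (f b - f a)).eq_or_lt with h0 | h0
  · rw [← h0]
    exact intervalIntegral.integral_nonneg hab fun t _ => norm_nonneg _
  -- Testing with the increment itself turns the scalar identity into the square of the norm.
  have h1 := hf.integral_inner_deriv (f b - f a)
  rw [real_inner_self_eq_norm_sq] at h1
  have h2 : ‖∫ t in a..b, ⟪f b - f a, deriv f t⟫‖ ≤ ∫ t in a..b, ‖f b - f a‖ * ‖deriv f t‖ :=
    intervalIntegral.norm_integral_le_of_norm_le hab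
      (Eventually.of_forall fun t _ => norm_inner_le_norm _ _)
      (hf.intervalIntegrable_norm_deriv.const_mul _)
  rw [h1, intervalIntegral.integral_const_mul, Real.norm_of_nonneg (sq_nonneg _), sq] at h2
  exact le_of_mul_le_mul_left h2 h0

end Euclidean

end AbsolutelyContinuousOnInterval

/-- A measurable function that is bounded below, and bounded above almost everywhere by the
derivative of a function which is monotone up to a linear term, is integrable. -/
theorem intervalIntegrable_and_integral_le_of_le_deriv {B g : ℝ → ℝ} {k M T : ℝ} (hT : 0 ≤ T)
    (hB : MonotoneOn (fun t => B t + k * t) (Icc 0 T))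
    (hg : AEStronglyMeasurable g (volume.restrict (Ioc 0 T)))
    (h : ∀ᵐ t, t ∈ Ioo 0 T → ∀ β, HasDerivAt B β t → -M ≤ g t ∧ g t ≤ β) :
    IntervalIntegrable g volume 0 T ∧ ∫ t in (0 : ℝ)..T, g t ≤ B T - B 0 := by
  set F : ℝ → ℝ := fun t => B t + k * t
  have hF : MonotoneOn F (uIcc 0 T) := by rwa [uIcc_of_le hT]
  have hFi := hF.intervalIntegrable_deriv
  -- A monotone function may have jumps and a singular part, so the integral of its derivative is
  -- only bounded by its increment; this is the direction needed.
  have hFm := hF.intervalIntegral_deriv_mem_uIcc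
  have h0 : F 0 ≤ F T := hB (by simp [hT]) (by simp [hT]) hT
  rw [uIcc_of_le (by linarith)] at hFm
  have hT' : ∀ᵐ t : ℝ, t ≠ T := by simp [ae_iff, measure_singleton]
  have key : ∀ᵐ t, t ∈ Ioc 0 T → -M ≤ g t ∧ g t ≤ deriv F t - k := by
    filter_upwards [h, hB.ae_differentiableWithinAt_of_mem, hT'] with t h1 h2 h3 ht
    have ht' : t ∈ Ioo 0 T := ⟨ht.1, lt_of_le_of_ne ht.2 h3⟩
    have hd := ((h2 (Ioc_subset_Icc_self ht)).differentiableAt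
      (Icc_mem_nhds ht'.1 ht'.2)).hasDerivAt
    refine h1 ht' _ ?_
    have := hd.sub ((hasDerivAt_id t).const_mul k)
    simp only [mul_one] at this
    refine this.congr_of_eventuallyEq (Eventually.of_forall fun s => ?_)
    simp [F]
  have hi : IntervalIntegrable (fun t => deriv F t - k) volume 0 T :=
    hFi.sub intervalIntegrable_const
  have hgi : IntervalIntegrable g volume 0 T := by
    refine IntervalIntegrable.mono_fun
      (hi.abs.add (intervalIntegrable_const (c := |M|))) (by rwa [uIoc_of_le hT]) ?_
    rw [uIoc_of_le hT, EventuallyLE, ae_restrict_iff' measurableSet_Ioc]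
    filter_upwards [key] with t ht htm
    obtain ⟨h1, h2⟩ := ht htm
    refine le_trans ?_ (le_abs_self _)
    simp only [Real.norm_eq_abs]
    refine abs_le.2 ⟨?_, ?_⟩
    · linarith [abs_nonneg (deriv F t - k), le_abs_self M]
    · linarith [le_abs_self (deriv F t - k), abs_nonneg M]
  refine ⟨hgi, ?_⟩
  have h1 : ∫ t in (0 : ℝ)..T, g t ≤ ∫ t in (0 : ℝ)..T, (deriv F t - k) := by
    refine intervalIntegral.integral_mono_ae_restrict hT hgi hi ?_
    rw [EventuallyLE, ← restrict_Ioc_eq_restrict_Icc, ae_restrict_iff' measurableSet_Ioc]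
    filter_upwards [key] with t ht htm using (ht htm).2
  rw [intervalIntegral.integral_sub hFi intervalIntegrable_const] at h1
  simp only [intervalIntegral.integral_const, sub_zero, smul_eq_mul] at h1
  have : F T - F 0 = B T - B 0 + k * T := by simp [F]; ring
  nlinarith [hFm.2]

/-- The derivative vanishes at almost all points of a level set. -/
theorem ae_hasDerivAt_eq_zero_of_eq {E : Type*} [NormedAddCommGroup E] [NormedSpace ℝ E]
    (f : ℝ → E) (x : E) : ∀ᵐ t, f t = x → ∀ d, HasDerivAt f d t → d = 0 := by
  -- Only countably many points of the level set are isolated in it from the right. At any other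
  -- point the slopes vanish along points of the level set.
  have hc := countable_setOfPred_isolated_right_within (s := {t | f t = x})
  have : ∀ᵐ t, t ∉ {t ∈ {t | f t = x} | 𝓝[{t | f t = x} ∩ Ioi t] t = ⊥} := by
    rw [ae_iff]; simpa using hc.measure_zero volume
  filter_upwards [this] with t ht htx d hd
  have hne : (𝓝[{t | f t = x} ∩ Ioi t] t).NeBot := ⟨fun h => ht ⟨htx, h⟩⟩
  have h1 : Tendsto (slope f t) (𝓝[{t | f t = x} ∩ Ioi t] t) (𝓝 d) :=
    (hasDerivAt_iff_tendsto_slope.1 hd).mono_left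
      (nhdsWithin_mono _ fun s hs => ne_of_gt hs.2)
  refine tendsto_nhds_unique h1 (tendsto_const_nhds.congr' ?_)
  filter_upwards [self_mem_nhdsWithin] with s hs
  have hs1 : f s = x := hs.1
  simp [slope, hs1, show f t = x from htx]

theorem Ultrafilter.exists_tendsto_of_mem {α X : Type*} [TopologicalSpace X] (U : Ultrafilter α)
    {K : Set X} (hK : IsCompact K) {f : α → X} (hf : ∀ n, f n ∈ K) :
    ∃ l ∈ K, Tendsto f U (𝓝 l) := by
  obtain ⟨l, hl, h⟩ := hK.ultrafilter_le_nhds (U.map f) (by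
    rw [le_principal_iff]; exact U.sets_of_superset univ_mem fun n _ => hf n)
  exact ⟨l, hl, h⟩

/-- The variation function is monotone and its increments dominate the distances, so its derivative
dominates the speed almost everywhere. -/
theorem AbsolutelyContinuousOnInterval.integral_norm_deriv_le_eVariationOn {N : ℕ}
    {f : ℝ → EuclideanSpace ℝ (Fin N)} {T : ℝ} (hT : 0 ≤ T)
    (hf : AbsolutelyContinuousOnInterval f 0 T) :
    ENNReal.ofReal (∫ t in (0 : ℝ)..T, ‖deriv f t‖) ≤ eVariationOn f (Icc 0 T) := by
  have hbv : BoundedVariationOn f (Icc 0 T) := by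
    have := hf.boundedVariationOn; rwa [uIcc_of_le hT] at this
  have hloc := hbv.locallyBoundedVariationOn
  have h0 : (0 : ℝ) ∈ Icc 0 T := by simp [hT]
  set V := variationOnFromTo f (Icc 0 T) 0
  have hV : MonotoneOn V (Icc 0 T) := variationOnFromTo.monotoneOn hloc h0
  have hd : ∀ s ∈ Icc 0 T, ∀ t ∈ Icc 0 T, s ≤ t → dist (f s) (f t) ≤ V t - V s := by
    intro s hs t ht hst
    have h1 : V t - V s = variationOnFromTo f (Icc 0 T) s t := by
      linarith [variationOnFromTo.add hloc h0 hs ht]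
    rw [h1, variationOnFromTo.eq_of_le _ _ hst, ← ENNReal.ofReal_le_iff_le_toReal (hloc s t hs ht),
      ← edist_dist]
    exact eVariationOn.edist_le _ ⟨hs, le_rfl, hst⟩ ⟨ht, hst, le_rfl⟩
  have h := (intervalIntegrable_and_integral_le_of_le_deriv (B := V) (k := 0) (M := 0) hT
    (by simpa using hV) (g := fun t => ‖deriv f t‖)
    (measurable_deriv f).norm.aestronglyMeasurable (by
      filter_upwards [hf.ae_hasDerivAt] with t ht htm β hβ
      refine ⟨by simp, ?_⟩
      have hfd := ht (by rw [uIcc_of_le hT]; exact Ioo_subset_Icc_self htm)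
      have h1 : Tendsto (fun s => ‖slope f t s‖) (𝓝[>] t) (𝓝 ‖deriv f t‖) :=
        ((hasDerivAt_iff_tendsto_slope.1 hfd).mono_left
          (nhdsWithin_mono _ fun s hs => ne_of_gt hs)).norm
      have h2 : Tendsto (slope V t) (𝓝[>] t) (𝓝 β) :=
        (hasDerivAt_iff_tendsto_slope.1 hβ).mono_left (nhdsWithin_mono _ fun s hs => ne_of_gt hs)
      refine le_of_tendsto_of_tendsto h1 h2 ?_
      filter_upwards [Ioo_mem_nhdsGT htm.2] with s hs
      rw [slope_def_field, slope_def_module, norm_smul, norm_inv,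
        Real.norm_of_nonneg (sub_nonneg.2 hs.1.le), div_eq_inv_mul, ← dist_eq_norm, dist_comm]
      exact mul_le_mul_of_nonneg_left (hd _ (Ioo_subset_Icc_self htm) _
        ⟨htm.1.le.trans hs.1.le, hs.2.le⟩ hs.1.le) (inv_nonneg.2 (sub_nonneg.2 hs.1.le)))).2
  refine ENNReal.ofReal_le_of_le_toReal (h.trans ?_)
  have hV0 : V 0 = 0 := variationOnFromTo.self _ _ _
  have hVT : V T = (eVariationOn f (Icc 0 T)).toReal := by
    simp only [V]
    rw [variationOnFromTo.eq_of_le _ _ hT, inter_self]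
  rw [hV0, hVT, sub_zero]

theorem LipschitzOnWith.volume_image_eq_zero {f : ℝ → ℝ} {K : NNReal} {s : Set ℝ}
    (hf : LipschitzOnWith K f s) (hs : volume s = 0) : volume (f '' s) = 0 := by
  have h := hf.hausdorffMeasure_image_le (d := 1) zero_le_one
  rw [hausdorffMeasure_real, hs, mul_zero] at h
  exact le_antisymm h bot_le

/-! ### Local geometry of the network and velocities of its curves. -/

namespace EmbeddedNetwork

variable {N : ℕ} {ι : Type*} (Γ : EmbeddedNetwork N ι)

theorem arc_rev_one (e : ι) : Γ.arc (Γ.rev e) 1 = Γ.arc e 0 := by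
  rw [Γ.arc_rev e 1 (by simp), sub_self]

theorem arc_zero_ne_arc_one (e : ι) : Γ.arc e 0 ≠ Γ.arc e 1 := fun h =>
  zero_ne_one (Γ.injOn_arc e (by simp) (by simp) h)

/-- An interior point of an arc lies on no other arc but the inverse one. -/
theorem eq_or_eq_rev_of_arc_eq {e e' : ι} {s s' : ℝ} (hs : s ∈ Ioo (0 : ℝ) 1)
    (hs' : s' ∈ Icc (0 : ℝ) 1) (h : Γ.arc e' s' = Γ.arc e s) :
    (e' = e ∧ s' = s) ∨ (e' = Γ.rev e ∧ s' = 1 - s) := by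
  by_cases h1 : e' = e
  · subst h1
    exact Or.inl ⟨rfl, Γ.injOn_arc _ hs' (Ioo_subset_Icc_self hs) h⟩
  by_cases h2 : e' = Γ.rev e
  · subst h2
    rw [Γ.arc_rev e s' hs'] at h
    have := Γ.injOn_arc e ⟨by linarith [hs'.2], by linarith [hs'.1]⟩ (Ioo_subset_Icc_self hs) h
    exact Or.inr ⟨rfl, by linarith⟩
  · exact absurd ⟨s', hs', h⟩
      (disjoint_left.1 (Γ.disjoint_arc e e' h1 h2) (mem_image_of_mem _ hs))

theorem arc_notMem_vertices {e : ι} {s : ℝ} (hs : s ∈ Ioo (0 : ℝ) 1) :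
    Γ.arc e s ∉ Γ.vertices := by
  rintro (⟨e', h⟩ | ⟨e', h⟩)
  · rcases Γ.eq_or_eq_rev_of_arc_eq hs (by simp) h with h | h <;> linarith [hs.1, hs.2]
  · rcases Γ.eq_or_eq_rev_of_arc_eq hs (by simp) h with h | h <;> linarith [hs.1, hs.2]

theorem arc_mem_carrier (e : ι) {s : ℝ} (hs : s ∈ Icc (0 : ℝ) 1) : Γ.arc e s ∈ Γ.carrier :=
  mem_iUnion.2 ⟨e, mem_image_of_mem _ hs⟩

theorem continuousOn_arc (e : ι) : ContinuousOn (Γ.arc e) (Icc 0 1) :=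
  (Γ.contDiffOn_arc e).continuousOn

theorem isCompact_carrier : IsCompact Γ.carrier :=
  have := Γ.finite
  isCompact_iUnion fun e => isCompact_Icc.image_of_continuousOn (Γ.continuousOn_arc e)

theorem finite_vertices : Γ.vertices.Finite :=
  have := Γ.finite
  (finite_range _).union (finite_range _)

theorem exists_arc_of_notMem_vertices {z : EuclideanSpace ℝ (Fin N)} (hz : z ∈ Γ.carrier)
    (hv : z ∉ Γ.vertices) : ∃ e, ∃ s ∈ Ioo (0 : ℝ) 1, Γ.arc e s = z := by
  obtain ⟨e, s, hs, rfl⟩ := mem_iUnion.1 hz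
  refine ⟨e, s, ⟨lt_of_le_of_ne hs.1 ?_, lt_of_le_of_ne hs.2 ?_⟩, rfl⟩
  · rintro rfl; exact hv (Or.inl ⟨e, rfl⟩)
  · rintro rfl; exact hv (Or.inr ⟨e, rfl⟩)

/-- A point of an arc close to `z₀` has its parameter close to a parameter of `z₀`. -/
theorem eventually_param_near (z₀ : EuclideanSpace ℝ (Fin N)) {ε : ℝ} (hε : 0 < ε) :
    ∀ᶠ z in 𝓝 z₀, ∀ e, ∀ s ∈ Icc (0 : ℝ) 1, Γ.arc e s = z →
      ∃ s₁ ∈ Icc (0 : ℝ) 1, Γ.arc e s₁ = z₀ ∧ |s - s₁| < ε := by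
  have := Γ.finite
  refine eventually_all.2 fun e => ?_
  -- The parameters outside `U` form a compact set whose image avoids `z₀`, hence avoids a
  -- neighbourhood of it.
  set U : Set ℝ := ⋃ s₁ ∈ {s₁ | s₁ ∈ Icc (0 : ℝ) 1 ∧ Γ.arc e s₁ = z₀}, Metric.ball s₁ ε
  have hU : IsOpen U := isOpen_biUnion fun _ _ => Metric.isOpen_ball
  have hK : IsCompact (Γ.arc e '' (Icc 0 1 \ U)) :=
    (isCompact_Icc.diff hU).image_of_continuousOn ((Γ.continuousOn_arc e).mono sdiff_subset)
  have hz : z₀ ∉ Γ.arc e '' (Icc 0 1 \ U) := by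
    rintro ⟨s, hs, h⟩
    exact hs.2 (mem_biUnion (show s ∈ {s₁ | s₁ ∈ Icc (0 : ℝ) 1 ∧ Γ.arc e s₁ = z₀} from ⟨hs.1, h⟩)
      (Metric.mem_ball_self hε))
  filter_upwards [hK.isClosed.isOpen_compl.mem_nhds hz] with z hz' s hs hsz
  have : s ∈ U := by
    by_contra h
    exact hz' ⟨s, ⟨hs, h⟩, hsz⟩
  simp only [U, mem_iUnion] at this
  obtain ⟨s₁, ⟨h1, h2⟩, h3⟩ := this
  exact ⟨s₁, h1, h2, by rwa [Metric.mem_ball, Real.dist_eq] at h3⟩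

/-- Around an interior point of an arc the network reduces to that arc; a nearby point presented
through the inverse arc is read backwards. -/
theorem eventually_mem_arc {e : ι} {s₀ : ℝ} (hs₀ : s₀ ∈ Ioo (0 : ℝ) 1) {ε : ℝ} (hε : 0 < ε) :
    ∀ᶠ z in 𝓝 (Γ.arc e s₀), z ∈ Γ.carrier → ∃ s ∈ Ioo (0 : ℝ) 1, |s - s₀| < ε ∧ Γ.arc e s = z := by
  have hδ : 0 < min ε (min s₀ (1 - s₀)) :=
    lt_min hε (lt_min hs₀.1 (by linarith [hs₀.2]))
  filter_upwards [Γ.eventually_param_near (Γ.arc e s₀) hδ] with z hz hzc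
  obtain ⟨e', s', hs', rfl⟩ := mem_iUnion.1 hzc
  obtain ⟨s₁, hs₁, h1, h2⟩ := hz e' s' hs' rfl
  rw [lt_min_iff, lt_min_iff, abs_lt, abs_lt, abs_lt] at h2
  rcases Γ.eq_or_eq_rev_of_arc_eq hs₀ hs₁ h1 with ⟨rfl, rfl⟩ | ⟨rfl, rfl⟩
  · exact ⟨s', ⟨by linarith [h2.2.1.1], by linarith [h2.2.2.2]⟩, abs_lt.2 h2.1, rfl⟩
  · refine ⟨1 - s', ⟨by linarith [h2.2.1.2, h2.2.2.2], by linarith [h2.2.2.1, h2.2.1.1]⟩,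
      abs_lt.2 ?_, ?_⟩
    · constructor <;> linarith [h2.1.1, h2.1.2]
    · rw [Γ.arc_rev e s' hs']

theorem tangent_ne_zero (e : ι) {s : ℝ} (hs : s ∈ Icc (0 : ℝ) 1) : Γ.tangent e s ≠ 0 :=
  Γ.derivWithin_arc_ne_zero e s hs

theorem continuousOn_tangent (e : ι) : ContinuousOn (Γ.tangent e) (Icc 0 1) :=
  (Γ.contDiffOn_arc e).continuousOn_derivWithin (uniqueDiffOn_Icc zero_lt_one) le_rfl

theorem hasStrictDerivAt_arc (e : ι) {s : ℝ} (hs : s ∈ Ioo (0 : ℝ) 1) :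
    HasStrictDerivAt (Γ.arc e) (Γ.tangent e s) s := by
  have hn : Icc (0 : ℝ) 1 ∈ 𝓝 s := Icc_mem_nhds hs.1 hs.2
  have h := ((Γ.contDiffOn_arc e).contDiffAt hn).hasStrictDerivAt one_ne_zero
  rwa [tangent, derivWithin_of_mem_nhds hn]

theorem tangent_rev (e : ι) {s : ℝ} (hs : s ∈ Ioo (0 : ℝ) 1) :
    Γ.tangent (Γ.rev e) s = -Γ.tangent e (1 - s) := by
  have hs' : 1 - s ∈ Ioo (0 : ℝ) 1 := ⟨by linarith [hs.2], by linarith [hs.1]⟩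
  have h1 := (Γ.hasStrictDerivAt_arc (Γ.rev e) hs).hasDerivAt
  have h2 := (Γ.hasStrictDerivAt_arc e hs').hasDerivAt.scomp s ((hasDerivAt_id s).const_sub 1)
  have h3 : HasDerivAt (Γ.arc (Γ.rev e)) ((-1 : ℝ) • Γ.tangent e (1 - s)) s := by
    refine h2.congr_of_eventuallyEq ?_
    filter_upwards [Icc_mem_nhds hs.1 hs.2] with r hr
    exact Γ.arc_rev e r hr
  rw [h1.unique h3, neg_one_smul]

theorem coord_rev (e : ι) {s : ℝ} (hs : s ∈ Ioo (0 : ℝ) 1) (q : EuclideanSpace ℝ (Fin N)) :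
    Γ.coord (Γ.rev e) s q = -Γ.coord e (1 - s) q := by
  simp [coord, Γ.tangent_rev e hs, neg_div]

theorem coord_smul_tangent (e : ι) {s : ℝ} (hs : s ∈ Icc (0 : ℝ) 1) (v : ℝ) :
    Γ.coord e s (v • Γ.tangent e s) = v := by
  have := norm_ne_zero_iff.2 (Γ.tangent_ne_zero e hs)
  rw [coord, real_inner_smul_left, real_inner_self_eq_norm_sq, mul_div_assoc,
    div_self (pow_ne_zero 2 this), mul_one]

/-- `q` is a possible velocity, at `z`, of a curve in the network, outside of a null set of times:
it vanishes at the vertices, and is tangent to the arc elsewhere. -/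
def IsVelocity (z q : EuclideanSpace ℝ (Fin N)) : Prop :=
  z ∈ Γ.carrier ∧ (z ∈ Γ.vertices → q = 0) ∧
    ∀ e, ∀ s ∈ Ioo (0 : ℝ) 1, Γ.arc e s = z → ∃ v : ℝ, q = v • Γ.tangent e s

variable {Γ} in
theorem IsVelocity.smul {z q : EuclideanSpace ℝ (Fin N)} (h : Γ.IsVelocity z q) (k : ℝ) :
    Γ.IsVelocity z (k • q) := by
  refine ⟨h.1, fun hz => by rw [h.2.1 hz, smul_zero], fun e s hs hz => ?_⟩
  obtain ⟨v, rfl⟩ := h.2.2 e s hs hz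
  exact ⟨k * v, smul_smul _ _ _⟩

/-- The scalar function `⟪τ, arc⟫` has strict derivative `‖τ‖² ≠ 0`, so it has a differentiable
local inverse. Near `t` the curve factors as the arc composed with this inverse and `⟪τ, ξ⟫`, and
the chain rule applies. -/
theorem exists_smul_tangent_of_hasDerivAt {ξ : ℝ → EuclideanSpace ℝ (Fin N)}
    {q : EuclideanSpace ℝ (Fin N)} {t : ℝ} (hξ : HasDerivAt ξ q t)
    (hm : ∀ᶠ r in 𝓝 t, ξ r ∈ Γ.carrier) {e : ι} {s : ℝ} (hs : s ∈ Ioo (0 : ℝ) 1)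
    (h : Γ.arc e s = ξ t) : ∃ v : ℝ, q = v • Γ.tangent e s := by
  set τ := Γ.tangent e s
  have hτ : ‖τ‖ ^ 2 ≠ 0 := pow_ne_zero 2 (norm_ne_zero_iff.2
    (Γ.tangent_ne_zero e (Ioo_subset_Icc_self hs)))
  have hf : HasStrictDerivAt (fun r => ⟪τ, Γ.arc e r⟫) (‖τ‖ ^ 2) s := by
    have := ((innerSL ℝ τ).hasStrictFDerivAt (x := Γ.arc e s)).comp_hasStrictDerivAt s
      (Γ.hasStrictDerivAt_arc e hs)
    rw [← real_inner_self_eq_norm_sq]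
    exact this
  set g := hf.localInverse (fun r => ⟪τ, Γ.arc e r⟫) _ _ hτ
  have hg : HasDerivAt g (‖τ‖ ^ 2)⁻¹ ⟪τ, Γ.arc e s⟫ := (hf.to_localInverse hτ).hasDerivAt
  have hgl : ∀ᶠ r in 𝓝 s, g ⟪τ, Γ.arc e r⟫ = r :=
    (hf.hasStrictFDerivAt_equiv hτ).eventually_left_inverse
  obtain ⟨ε, hε, hball⟩ := Metric.eventually_nhds_iff.1 hgl
  have hgs : g ⟪τ, Γ.arc e s⟫ = s := hgl.self_of_nhds
  have hev : ξ =ᶠ[𝓝 t] fun r => Γ.arc e (g ⟪τ, ξ r⟫) := by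
    have h1 := Γ.eventually_mem_arc (e := e) hs hε
    rw [h] at h1
    filter_upwards [hm, hξ.continuousAt.eventually h1] with r hr1 hr2
    obtain ⟨s', -, h3, h4⟩ := hr2 hr1
    rw [← h4, hball (by rwa [Real.dist_eq])]
  have h1 : HasDerivAt (fun r => ⟪τ, ξ r⟫) ⟪τ, q⟫ t := by
    simpa using (hasDerivAt_const t τ).inner ℝ hξ
  rw [h] at hg
  have h2 := hg.comp t h1
  have h3 : HasDerivAt (Γ.arc e) τ ((g ∘ fun r => ⟪τ, ξ r⟫) t) := by
    simp only [Function.comp]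
    rw [← h, hgs]
    exact (Γ.hasStrictDerivAt_arc e hs).hasDerivAt
  exact ⟨_, hξ.unique ((h3.scomp t h2).congr_of_eventuallyEq hev)⟩

/-- The vertices are finitely many, and the derivative vanishes a.e. on each of their level sets.
Hence at a vertex only the value `-c x` of the Lagrangian contributes to an action. -/
theorem ae_isVelocity {ξ : ℝ → EuclideanSpace ℝ (Fin N)} {a b : ℝ}
    (hξ : AbsolutelyContinuousOnInterval ξ a b) (hm : MapsTo ξ (Icc a b) Γ.carrier) :
    ∀ᵐ t, t ∈ Ioo a b → HasDerivAt ξ (deriv ξ t) t ∧ Γ.IsVelocity (ξ t) (deriv ξ t) := by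
  have hv : ∀ᵐ t, ∀ x ∈ Γ.vertices, ξ t = x → ∀ d, HasDerivAt ξ d t → d = 0 :=
    (ae_ball_iff Γ.finite_vertices.countable).2 fun x _ => ae_hasDerivAt_eq_zero_of_eq ξ x
  filter_upwards [hv, hξ.ae_hasDerivAt] with t h1 h2 ht
  have hd := h2 (Icc_subset_uIcc (Ioo_subset_Icc_self ht))
  refine ⟨hd, hm (Ioo_subset_Icc_self ht), fun hx => h1 _ hx rfl _ hd, fun e s hs h => ?_⟩
  refine Γ.exists_smul_tangent_of_hasDerivAt hd ?_ hs h
  filter_upwards [Icc_mem_nhds ht.1 ht.2] with r hr using hm hr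

end EmbeddedNetwork

/-! ### Bounds, convexity and measurability of the Lagrangian. -/

namespace EmbeddedNetwork

variable {N : ℕ} {ι : Type*} (Γ : EmbeddedNetwork N ι)

theorem exists_forall_le_of_mono {ι : Type*} [Finite ι] {P : ι → ℝ → Prop}
    (hP : ∀ e K K', K ≤ K' → P e K → P e K') (h : ∀ e, ∃ K, P e K) : ∃ K, 0 ≤ K ∧ ∀ e, P e K := by
  choose K hK using h
  obtain ⟨M, hM⟩ := (finite_range K).bddAbove
  exact ⟨max M 0, le_max_right _ _, fun e =>
    hP e _ _ ((hM (mem_range_self e)).trans (le_max_left _ _)) (hK e)⟩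

theorem exists_bound_on_vertices (c : EuclideanSpace ℝ (Fin N) → ℝ) :
    ∃ K, 0 ≤ K ∧ ∀ x ∈ Γ.vertices, |c x| ≤ K := by
  obtain ⟨K, hK⟩ := (Γ.finite_vertices.image fun x => |c x|).bddAbove
  exact ⟨max K 0, le_max_right _ _, fun x hx => (hK (mem_image_of_mem _ hx)).trans (le_max_left _ _)⟩

theorem exists_tangent_bound : ∃ D, 0 ≤ D ∧ ∀ e, ∀ s ∈ Icc (0 : ℝ) 1,
    ‖Γ.tangent e s‖ ≤ D ∧ ‖Γ.tangent e s‖⁻¹ ≤ D := by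
  have := Γ.finite
  refine exists_forall_le_of_mono (fun e K K' h hK s hs =>
    ⟨(hK s hs).1.trans h, (hK s hs).2.trans h⟩) fun e => ?_
  have h1 := (Γ.continuousOn_tangent e).norm
  obtain ⟨A, hA⟩ := isCompact_Icc.exists_bound_of_continuousOn h1
  obtain ⟨B, hB⟩ := isCompact_Icc.exists_bound_of_continuousOn
    (h1.inv₀ fun s hs => norm_ne_zero_iff.2 (Γ.tangent_ne_zero e hs))
  refine ⟨max A B, fun s hs => ⟨?_, ?_⟩⟩
  · simpa using (hA s hs).trans (le_max_left _ _)
  · simpa using (hB s hs).trans (le_max_right _ _)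

variable {Γ} in
/-- To check a property of the Lagrangian at the velocities, it is enough to look at the
interior points of the arcs and at the vertices. -/
theorem IsVelocity.induction {P : EuclideanSpace ℝ (Fin N) → EuclideanSpace ℝ (Fin N) → Prop}
    (harc : ∀ e, ∀ s ∈ Ioo (0 : ℝ) 1, ∀ v : ℝ, P (Γ.arc e s) (v • Γ.tangent e s))
    (hvert : ∀ x ∈ Γ.vertices, P x 0) {z q : EuclideanSpace ℝ (Fin N)} (h : Γ.IsVelocity z q) :
    P z q := by
  by_cases hz : z ∈ Γ.vertices
  · rw [h.2.1 hz]; exact hvert z hz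
  · obtain ⟨e, s, hs, rfl⟩ := Γ.exists_arc_of_notMem_vertices h.1 hz
    obtain ⟨v, rfl⟩ := h.2.2 e s hs rfl
    exact harc e s hs v

namespace Hamiltonian

variable {Γ} (H : Γ.Hamiltonian)

theorem exists_abs_le (R : ℝ) :
    ∃ M, 0 ≤ M ∧ ∀ e, ∀ s ∈ Icc (0 : ℝ) 1, ∀ μ, |μ| ≤ R → |H.toFun e s μ| ≤ M := by
  have := Γ.finite
  refine exists_forall_le_of_mono (fun e K K' h hK s hs μ hμ => (hK s hs μ hμ).trans h) fun e => ?_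
  obtain ⟨A, hA⟩ := (isCompact_Icc.prod (isCompact_Icc (a := -R) (b := R))
    ).exists_bound_of_continuousOn
    ((H.continuousOn e).mono (prod_mono le_rfl (subset_univ _)))
  exact ⟨A, fun s hs μ hμ => hA (s, μ) ⟨hs, abs_le.1 hμ⟩⟩

theorem exists_le_toFun (R : ℝ) :
    ∃ K, 0 ≤ K ∧ ∀ e, ∀ s ∈ Icc (0 : ℝ) 1, ∀ μ, R * |μ| - K ≤ H.toFun e s μ := by
  have := Γ.finite
  refine exists_forall_le_of_mono (fun e K K' h hK s hs μ => le_trans (by linarith) (hK s hs μ))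
    fun e => ?_
  obtain ⟨t, ht, hsub⟩ := mem_cocompact.1 ((H.superlinear e).eventually_ge_atTop R)
  obtain ⟨A, hA⟩ := (ht.union (isCompact_singleton (x := (0 : ℝ)))).isBounded.exists_norm_le
  obtain ⟨M, hM, hM'⟩ := H.exists_abs_le A
  refine ⟨|R| * A + M, fun s hs μ => ?_⟩
  have hA0 : 0 ≤ A := (norm_nonneg _).trans (hA 0 (by simp))
  by_cases hμ : μ ∈ t ∪ {0}
  · have h1 : |μ| ≤ A := hA μ hμ
    have h2 := abs_le.1 (hM' e s hs μ h1)
    have h3 : R * |μ| ≤ |R| * A :=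
      mul_le_mul (le_abs_self R) h1 (abs_nonneg _) (abs_nonneg _)
    linarith
  · rw [mem_union, not_or] at hμ
    have hμ0 : 0 < |μ| := abs_pos.2 hμ.2
    have h1 : R ≤ ⨅ s : Icc (0 : ℝ) 1, H.toFun e s μ / |μ| := hsub hμ.1
    obtain ⟨M', -, hM''⟩ := H.exists_abs_le |μ|
    -- A real infimum is below the values only for a family bounded below; here continuity on the
    -- compact interval supplies the bound.
    have hbdd : BddBelow (range fun s : Icc (0 : ℝ) 1 => H.toFun e s μ / |μ|) := by
      refine ⟨-M' / |μ|, ?_⟩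
      rintro _ ⟨s, rfl⟩
      exact div_le_div_of_nonneg_right (abs_le.1 (hM'' e s s.2 μ le_rfl)).1 hμ0.le
    have h2 := h1.trans (ciInf_le hbdd ⟨s, hs⟩)
    rw [le_div_iff₀ hμ0] at h2
    have : 0 ≤ |R| * A := by positivity
    simp only at h2
    linarith

theorem bddAbove_range (e : ι) {s : ℝ} (hs : s ∈ Icc (0 : ℝ) 1) (v : ℝ) :
    BddAbove (range fun μ : ℝ => v * μ - H.toFun e s μ) := by
  obtain ⟨K, -, hK⟩ := H.exists_le_toFun |v|
  refine ⟨K, ?_⟩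
  rintro _ ⟨μ, rfl⟩
  have h1 := hK e s hs μ
  have h2 : v * μ ≤ |v| * |μ| := by rw [← abs_mul]; exact le_abs_self _
  simp only
  linarith

theorem le_arcLagrangian (e : ι) {s : ℝ} (hs : s ∈ Icc (0 : ℝ) 1) (v μ : ℝ) :
    v * μ - H.toFun e s μ ≤ H.arcLagrangian e s v :=
  le_ciSup (H.bddAbove_range e hs v) μ

theorem arcLagrangian_rev (e : ι) {s : ℝ} (hs : s ∈ Icc (0 : ℝ) 1) (v : ℝ) :
    H.arcLagrangian (Γ.rev e) s v = H.arcLagrangian e (1 - s) (-v) := by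
  rw [arcLagrangian, arcLagrangian, ← (Equiv.neg ℝ).iSup_comp]
  refine iSup_congr fun μ => ?_
  simp [H.rev_eq e s hs]

/-- A countable supremum preserves measurability, which is what this form is for. -/
theorem arcLagrangian_eq_iSup_rat (e : ι) {s : ℝ} (hs : s ∈ Icc (0 : ℝ) 1) (v : ℝ) :
    H.arcLagrangian e s v = ⨆ r : ℚ, (v * r - H.toFun e s r) := by
  have hb : BddAbove (range fun r : ℚ => v * (r : ℝ) - H.toFun e s r) :=
    (H.bddAbove_range e hs v).mono (by rintro _ ⟨r, rfl⟩; exact ⟨(r : ℝ), rfl⟩)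
  refine le_antisymm (ciSup_le fun μ => ?_) (ciSup_le fun r => H.le_arcLagrangian e hs v r)
  have hc : Continuous fun μ => H.toFun e s μ :=
    (H.continuousOn e).comp_continuous (f := fun μ => (s, μ)) (by fun_prop) fun μ => ⟨hs, mem_univ _⟩
  refine Rat.denseRange_cast.induction_on μ
    (p := fun μ : ℝ => v * μ - H.toFun e s μ ≤ ⨆ r : ℚ, (v * r - H.toFun e s r))
    (isClosed_le (by fun_prop) continuous_const) fun r => le_ciSup hb r

variable (c : EuclideanSpace ℝ (Fin N) → ℝ)

theorem lagrangian_arc (e : ι) {s : ℝ} (hs : s ∈ Ioo (0 : ℝ) 1) (q : EuclideanSpace ℝ (Fin N)) :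
    H.lagrangian c (Γ.arc e s) q = H.arcLagrangian e s (Γ.coord e s q) := by
  rw [lagrangian, if_neg (Γ.arc_notMem_vertices hs)]
  convert csInf_singleton (H.arcLagrangian e s (Γ.coord e s q)) using 1
  congr 1
  ext l
  constructor
  · rintro ⟨e', s', hs', h, rfl⟩
    rcases Γ.eq_or_eq_rev_of_arc_eq hs (Ioo_subset_Icc_self hs') h with ⟨rfl, rfl⟩ | ⟨rfl, rfl⟩
    · rfl
    · rw [H.arcLagrangian_rev e (Ioo_subset_Icc_self hs'), Γ.coord_rev e hs', neg_neg, sub_sub_cancel]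
      rfl
  · rintro rfl
    exact ⟨e, s, hs, rfl, rfl⟩

theorem lagrangian_arc_smul (e : ι) {s : ℝ} (hs : s ∈ Ioo (0 : ℝ) 1) (v : ℝ) :
    H.lagrangian c (Γ.arc e s) (v • Γ.tangent e s) = H.arcLagrangian e s v := by
  rw [H.lagrangian_arc c e hs, Γ.coord_smul_tangent e (Ioo_subset_Icc_self hs)]

theorem lagrangian_vertex {x : EuclideanSpace ℝ (Fin N)} (hx : x ∈ Γ.vertices) :
    H.lagrangian c x 0 = -c x := by
  rw [lagrangian, if_pos hx, if_pos rfl]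

/-- Testing the supremum with `μ` of the sign of `v` and size `|R| * D`, where `D` bounds the
tangents, produces the linear term, while the Hamiltonians are bounded for bounded `μ`. -/
theorem exists_le_lagrangian (R : ℝ) : ∃ M, 0 ≤ M ∧ ∀ z q, Γ.IsVelocity z q →
    R * ‖q‖ - M ≤ H.lagrangian c z q := by
  obtain ⟨D, hD, hD'⟩ := Γ.exists_tangent_bound
  obtain ⟨M, hM, hM'⟩ := H.exists_abs_le (|R| * D)
  obtain ⟨K, hK, hK'⟩ := Γ.exists_bound_on_vertices c
  refine ⟨M + K, by positivity, fun z q hzq =>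
    hzq.induction (P := fun z q => R * ‖q‖ - (M + K) ≤ H.lagrangian c z q) ?_ ?_⟩
  · intro e s hs v
    have hs' := Ioo_subset_Icc_self hs
    rw [H.lagrangian_arc_smul c e hs, norm_smul, Real.norm_eq_abs]
    have h1 : R * (|v| * ‖Γ.tangent e s‖) ≤ |v| * (|R| * D) := by
      calc R * (|v| * ‖Γ.tangent e s‖) ≤ |R| * (|v| * D) := by
            refine mul_le_mul (le_abs_self R) (mul_le_mul_of_nonneg_left (hD' e s hs').1
              (abs_nonneg _)) (by positivity) (abs_nonneg _)
        _ = _ := by ring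
    have hRD : 0 ≤ |R| * D := by positivity
    rcases le_total 0 v with hv | hv
    · have h2 := H.le_arcLagrangian e hs' v (|R| * D)
      have h3 := abs_le.1 (hM' e s hs' (|R| * D) (abs_of_nonneg hRD).le)
      rw [abs_of_nonneg hv] at h1 ⊢
      linarith
    · have h2 := H.le_arcLagrangian e hs' v (-(|R| * D))
      have h3 := abs_le.1 (hM' e s hs' (-(|R| * D)) (by rw [abs_neg]; exact (abs_of_nonneg hRD).le))
      rw [abs_of_nonpos hv] at h1 ⊢
      linarith
  · intro x hx
    rw [H.lagrangian_vertex c hx, norm_zero]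
    linarith [(abs_le.1 (hK' x hx)).2]

theorem exists_lagrangian_le (R : ℝ) : ∃ M, 0 ≤ M ∧ ∀ z q, Γ.IsVelocity z q → ‖q‖ ≤ R →
    H.lagrangian c z q ≤ M := by
  obtain ⟨D, hD, hD'⟩ := Γ.exists_tangent_bound
  obtain ⟨M, hM, hM'⟩ := H.exists_le_toFun (R * D)
  obtain ⟨K, hK, hK'⟩ := Γ.exists_bound_on_vertices c
  refine ⟨M + K, by positivity, fun z q hzq =>
    hzq.induction (P := fun z q => ‖q‖ ≤ R → H.lagrangian c z q ≤ M + K) ?_ ?_⟩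
  · intro e s hs v hv
    have hs' := Ioo_subset_Icc_self hs
    rw [H.lagrangian_arc_smul c e hs]
    rw [norm_smul, Real.norm_eq_abs] at hv
    have hτ := norm_pos_iff.2 (Γ.tangent_ne_zero e hs')
    have h1 : |v| ≤ R * D := by
      calc |v| = |v| * ‖Γ.tangent e s‖ * ‖Γ.tangent e s‖⁻¹ := by field_simp
        _ ≤ R * D := mul_le_mul hv (hD' e s hs').2 (by positivity) ((by positivity : (0:ℝ) ≤ _).trans hv)
    refine ciSup_le fun μ => ?_
    have h2 := hM' e s hs' μ
    have h3 : v * μ ≤ R * D * |μ| := by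
      refine (le_abs_self _).trans ?_
      rw [abs_mul]
      exact mul_le_mul_of_nonneg_right h1 (abs_nonneg _)
    linarith
  · intro x hx _
    rw [H.lagrangian_vertex c hx]
    linarith [(abs_le.1 (hK' x hx)).1]

/-- The increase of the action of a motion of bounded speed, when it is run faster. -/
theorem exists_mul_lagrangian_inv_smul_le (R : ℝ) : ∃ K, 0 ≤ K ∧ ∀ z q, Γ.IsVelocity z q → ‖q‖ ≤ R →
    ∀ w ∈ Icc (1 / 2 : ℝ) 1, w * H.lagrangian c z (w⁻¹ • q) ≤ H.lagrangian c z q + K * (1 - w) := by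
  obtain ⟨M, hM, hM'⟩ := H.exists_lagrangian_le c (2 * R)
  obtain ⟨M₀, hM₀, hM₀'⟩ := H.exists_le_lagrangian c 0
  obtain ⟨A, hA, hA'⟩ := Γ.exists_bound_on_vertices c
  refine ⟨M + 2 * M₀ + A, by positivity, fun z q hzq hq w hw => ?_⟩
  have hw0 : 0 < w := by linarith [hw.1]
  have hq2 : ‖(2 : ℝ) • q‖ ≤ 2 * R := by
    rw [norm_smul]; simpa using hq
  have h1 := hM' z _ (hzq.smul 2) hq2
  have h2 := hM₀' z q hzq
  rw [zero_mul, zero_sub] at h2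
  -- Convexity: `w⁻¹ • q` is the combination of `q` and `2 • q` with weights `(2w - 1)/w` and `(1 -
  -- w)/w`, both nonnegative since `w ∈ [1/2, 1]`. The excess over the Lagrangian at `q` is then `1
  -- - w` times a bounded quantity.
  suffices h : w * H.lagrangian c z (w⁻¹ • q) ≤
      (2 * w - 1) * H.lagrangian c z q + (1 - w) * H.lagrangian c z ((2 : ℝ) • q) + A * (1 - w) by
    have h3 : (1 - w) * H.lagrangian c z ((2 : ℝ) • q) ≤ (1 - w) * M :=
      mul_le_mul_of_nonneg_left h1 (by linarith [hw.2])
    have h4 : (1 - w) * -M₀ ≤ (1 - w) * H.lagrangian c z q :=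
      mul_le_mul_of_nonneg_left h2 (by linarith [hw.2])
    linarith
  clear h1 h2 hq hq2
  have hA1 : ∀ a ≤ A, (1 - w) * a ≤ A * (1 - w) := fun a ha => by
    rw [mul_comm]; exact mul_le_mul_of_nonneg_right ha (by linarith [hw.2])
  refine hzq.induction (P := fun z q => w * H.lagrangian c z (w⁻¹ • q) ≤
    (2 * w - 1) * H.lagrangian c z q + (1 - w) * H.lagrangian c z ((2 : ℝ) • q) + A * (1 - w)) ?_ ?_
  · intro e s hs v
    have hs' := Ioo_subset_Icc_self hs
    rw [smul_smul, smul_smul, H.lagrangian_arc_smul c e hs, H.lagrangian_arc_smul c e hs,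
      H.lagrangian_arc_smul c e hs]
    have h0 := hA1 0 hA
    refine le_trans ?_ (le_add_of_nonneg_right (by linarith))
    rw [← le_div_iff₀' hw0]
    refine ciSup_le fun μ => ?_
    rw [le_div_iff₀' hw0]
    have h1 := mul_le_mul_of_nonneg_left (H.le_arcLagrangian e hs' v μ)
      (by linarith [hw.1] : 0 ≤ 2 * w - 1)
    have h2 := mul_le_mul_of_nonneg_left (H.le_arcLagrangian e hs' (2 * v) μ)
      (by linarith [hw.2] : 0 ≤ 1 - w)
    have h3 : w * (w⁻¹ * v * μ - H.toFun e s μ) = v * μ - w * H.toFun e s μ := by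
      field_simp
    rw [h3]
    linarith
  · intro x hx
    rw [smul_zero, smul_zero, H.lagrangian_vertex c hx]
    have := hA1 _ (abs_le.1 (hA' x hx)).2
    have h2 := hA1 _ (by linarith [(abs_le.1 (hA' x hx)).1] : -c x ≤ A)
    linarith

/-- The times are split according to position. While the curve is on an arc away from the vertices
its parameter is continuous, and the Lagrangian is a countable supremum of measurable functions. On
the times spent at a vertex it is a.e. constant. -/
theorem aemeasurable_lagrangian {ξ : ℝ → EuclideanSpace ℝ (Fin N)} {T : ℝ} (hT : 0 ≤ T)
    (hξ : AbsolutelyContinuousOnInterval ξ 0 T) (hm : MapsTo ξ (Icc 0 T) Γ.carrier) :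
    AEMeasurable (fun t => H.lagrangian c (ξ t) (deriv ξ t)) (volume.restrict (Ioc 0 T)) := by
  have := Γ.finite
  have := Γ.finite_vertices.to_subtype
  have hcont : ContinuousOn ξ (Icc 0 T) := by simpa [uIcc_of_le hT] using hξ.continuousOn
  have hmeas : ∀ F : Set (EuclideanSpace ℝ (Fin N)), IsClosed F →
      MeasurableSet (Icc 0 T ∩ ξ ⁻¹' F) := fun F hF =>
    (hcont.preimage_isClosed_of_isClosed isClosed_Icc hF).measurableSet
  set S : ι → Set ℝ := fun e => (Icc 0 T ∩ ξ ⁻¹' (Γ.arc e '' Icc 0 1)) \ (Icc 0 T ∩ ξ ⁻¹' Γ.vertices)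
  have hSm : ∀ e, MeasurableSet (S e) := fun e =>
    (hmeas _ (isCompact_Icc.image_of_continuousOn (Γ.continuousOn_arc e)).isClosed).diff
      (hmeas _ Γ.finite_vertices.isClosed)
  set Z : Γ.vertices → Set ℝ := fun x => Ioo 0 T ∩ ξ ⁻¹' {x.1}
  have hZm : ∀ x, MeasurableSet (Z x) := fun x => by
    have : Z x = Ioo 0 T ∩ (Icc 0 T ∩ ξ ⁻¹' {x.1}) := by
      rw [← inter_assoc, inter_eq_self_of_subset_left Ioo_subset_Icc_self]
    rw [this]
    exact measurableSet_Ioo.inter (hmeas _ isClosed_singleton)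
  have hS : ∀ e, AEMeasurable (fun t => H.lagrangian c (ξ t) (deriv ξ t)) (volume.restrict (S e)) := by
    intro e
    have hex : ∀ t, ∃ s, t ∈ S e → s ∈ Ioo (0 : ℝ) 1 ∧ Γ.arc e s = ξ t := fun t => by
      by_cases ht : t ∈ S e
      · obtain ⟨⟨htT, s, hs, h⟩, h2⟩ := ht
        refine ⟨s, fun _ => ⟨⟨lt_of_le_of_ne hs.1 ?_, lt_of_le_of_ne hs.2 ?_⟩, h⟩⟩
        · rintro rfl; exact h2 ⟨htT, Or.inl ⟨e, h⟩⟩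
        · rintro rfl; exact h2 ⟨htT, Or.inr ⟨e, h⟩⟩
      · exact ⟨0, fun h => absurd h ht⟩
    choose σ hσ using hex
    have hσc : ContinuousOn σ (S e) := by
      intro t ht
      rw [ContinuousWithinAt, Metric.tendsto_nhds]
      intro ε hε
      have hc : ContinuousWithinAt ξ (S e) t := (hcont t ht.1.1).mono fun r hr => hr.1.1
      filter_upwards [hc.eventually (Γ.eventually_param_near (ξ t) hε), self_mem_nhdsWithin]
        with r hr hrS
      obtain ⟨s₁, hs₁, h1, h2⟩ := hr e (σ r) (Ioo_subset_Icc_self (hσ r hrS).1) (hσ r hrS).2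
      have : s₁ = σ t := Γ.injOn_arc e hs₁ (Ioo_subset_Icc_self (hσ t ht).1)
        (h1.trans (hσ t ht).2.symm)
      rwa [Real.dist_eq, ← this]
    have hmaps : MapsTo σ (S e) (Icc 0 1) := fun t ht => Ioo_subset_Icc_self (hσ t ht).1
    have hτ : AEMeasurable (fun t => Γ.tangent e (σ t)) (volume.restrict (S e)) :=
      ((Γ.continuousOn_tangent e).comp hσc hmaps).aemeasurable (hSm e)
    have hr : ∀ r : ℚ, AEMeasurable (fun t => Γ.coord e (σ t) (deriv ξ t) * r - H.toFun e (σ t) r)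
        (volume.restrict (S e)) := fun r => by
      have h1 : ContinuousOn (fun t => H.toFun e (σ t) r) (S e) :=
        (H.continuousOn e).comp (f := fun t => (σ t, (r : ℝ))) (by fun_prop)
          fun t ht => ⟨hmaps ht, mem_univ _⟩
      refine AEMeasurable.sub (AEMeasurable.mul_const ?_ _) (h1.aemeasurable (hSm e))
      exact ((measurable_deriv ξ).aemeasurable.inner hτ).div (hτ.norm.pow_const 2)
    refine (AEMeasurable.iSup hr).congr ?_
    rw [EventuallyEq, ae_restrict_iff' (hSm e)]
    refine Eventually.of_forall fun t ht => ?_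
    obtain ⟨h1, h2⟩ := hσ t ht
    rw [← h2, H.lagrangian_arc c e h1, H.arcLagrangian_eq_iSup_rat e (Ioo_subset_Icc_self h1)]
  have hZ : ∀ x, AEMeasurable (fun t => H.lagrangian c (ξ t) (deriv ξ t)) (volume.restrict (Z x)) := by
    intro x
    refine (aemeasurable_const (b := -c x)).congr ?_
    rw [EventuallyEq, ae_restrict_iff' (hZm x)]
    filter_upwards [Γ.ae_isVelocity hξ hm] with t ht htZ
    have h1 : ξ t = x := htZ.2
    have hv : ξ t ∈ Γ.vertices := h1 ▸ x.2
    rw [(ht htZ.1).2.2.1 hv, H.lagrangian_vertex c hv, h1]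
  have hU := (AEMeasurable.iUnion hS)
  have hU' := (AEMeasurable.iUnion hZ)
  have hall := aemeasurable_union_iff.2 ⟨hU, hU'⟩
  rw [restrict_Ioo_eq_restrict_Ioc.symm]
  refine hall.mono_measure (Measure.restrict_mono (fun t ht => ?_) le_rfl)
  by_cases hv : ξ t ∈ Γ.vertices
  · exact Or.inr (mem_iUnion.2 ⟨⟨ξ t, hv⟩, ht, rfl⟩)
  · obtain ⟨e, s, hs, h⟩ := Γ.exists_arc_of_notMem_vertices (hm (Ioo_subset_Icc_self ht)) hv
    exact Or.inl (mem_iUnion.2 ⟨e, ⟨Ioo_subset_Icc_self ht, s, Ioo_subset_Icc_self hs, h⟩,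
      fun h => hv h.2⟩)

end Hamiltonian

end EmbeddedNetwork

/-! ### Local lower bounds of the action by the endpoints. -/

namespace EmbeddedNetwork

namespace Hamiltonian

variable {N : ℕ} {ι : Type*} {Γ : EmbeddedNetwork N ι} (H : Γ.Hamiltonian)
  (c : EuclideanSpace ℝ (Fin N) → ℝ)

/-- Near `z₀`, the action of a curve is bounded from below by a function of its endpoints, up to
a multiple of the time. -/
def HasLocalBound (z₀ : EuclideanSpace ℝ (Fin N))
    (Φ : EuclideanSpace ℝ (Fin N) → EuclideanSpace ℝ (Fin N) → ℝ) (κ : ℝ) : Prop :=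
  ∃ ρ > 0, ∀ (ξ : ℝ → EuclideanSpace ℝ (Fin N)) (a b : ℝ), a ≤ b →
    AbsolutelyContinuousOnInterval ξ a b →
    (∀ t ∈ Icc a b, ξ t ∈ Γ.carrier ∧ dist (ξ t) z₀ < ρ) →
    IntervalIntegrable (fun t => H.lagrangian c (ξ t) (deriv ξ t)) volume a b →
    Φ (ξ a) (ξ b) - κ * (b - a) ≤ ∫ t in a..b, H.lagrangian c (ξ t) (deriv ξ t)

theorem integral_mono_of_ae_Ioo {f g : ℝ → ℝ} {a b : ℝ} (hab : a ≤ b)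
    (hf : IntervalIntegrable f volume a b) (hg : IntervalIntegrable g volume a b)
    (h : ∀ᵐ t, t ∈ Ioo a b → f t ≤ g t) : ∫ t in a..b, f t ≤ ∫ t in a..b, g t := by
  refine intervalIntegral.integral_mono_ae_restrict hab hf hg ?_
  rw [EventuallyLE, ← restrict_Ioo_eq_restrict_Icc, ae_restrict_iff' measurableSet_Ioo]
  exact h

theorem exists_inner_tangent_eq (e : ι) {s : ℝ} (hs : s ∈ Icc (0 : ℝ) 1) (μ : ℝ) :
    ∃ p : EuclideanSpace ℝ (Fin N), ⟪p, Γ.tangent e s⟫ = μ := by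
  refine ⟨(μ / ‖Γ.tangent e s‖ ^ 2) • Γ.tangent e s, ?_⟩
  rw [real_inner_smul_left, real_inner_self_eq_norm_sq, div_mul_cancel₀]
  exact pow_ne_zero 2 (norm_ne_zero_iff.2 (Γ.tangent_ne_zero e hs))

theorem eventually_toFun_inner_lt (e : ι) {s₀ : ℝ} (hs : s₀ ∈ Icc (0 : ℝ) 1)
    (p : EuclideanSpace ℝ (Fin N)) {κ : ℝ} (h : H.toFun e s₀ ⟪p, Γ.tangent e s₀⟫ < κ) :
    ∀ᶠ s in 𝓝[Icc 0 1] s₀, H.toFun e s ⟪p, Γ.tangent e s⟫ < κ := by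
  have h1 : ContinuousOn (fun s => H.toFun e s ⟪p, Γ.tangent e s⟫) (Icc 0 1) :=
    (H.continuousOn e).comp (f := fun s => (s, ⟪p, Γ.tangent e s⟫))
      (continuousOn_id.prodMk (continuousOn_const.inner (Γ.continuousOn_tangent e)))
      fun s hs => ⟨hs, mem_univ _⟩
  exact (h1 s₀ hs).eventually (gt_mem_nhds h)

theorem le_lagrangian_arc (e : ι) {s : ℝ} (hs : s ∈ Ioo (0 : ℝ) 1) (p : EuclideanSpace ℝ (Fin N))
    {q : EuclideanSpace ℝ (Fin N)} (hq : Γ.IsVelocity (Γ.arc e s) q) :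
    ⟪p, q⟫ - H.toFun e s ⟪p, Γ.tangent e s⟫ ≤ H.lagrangian c (Γ.arc e s) q := by
  obtain ⟨v, rfl⟩ := hq.2.2 e s hs rfl
  rw [H.lagrangian_arc_smul c e hs, real_inner_smul_right]
  exact H.le_arcLagrangian e (Ioo_subset_Icc_self hs) _ _

/-- For a fixed covector `p`, Fenchel's inequality integrates to a quantity depending on the
endpoints only. The strict inequality in `hκ` leaves room for moving `s` near `s₀`. -/
theorem hasLocalBound_arc (e : ι) {s₀ : ℝ} (hs₀ : s₀ ∈ Ioo (0 : ℝ) 1)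
    (p : EuclideanSpace ℝ (Fin N)) {κ : ℝ} (hκ : H.toFun e s₀ ⟪p, Γ.tangent e s₀⟫ < κ) :
    H.HasLocalBound c (Γ.arc e s₀) (fun z w => ⟪p, w - z⟫) κ := by
  have h1 := H.eventually_toFun_inner_lt e (Ioo_subset_Icc_self hs₀) p hκ
  rw [nhdsWithin_eq_nhds.2 (Icc_mem_nhds hs₀.1 hs₀.2)] at h1
  obtain ⟨δ, hδ, hδ'⟩ := Metric.eventually_nhds_iff.1 h1
  obtain ⟨ρ, hρ, hρ'⟩ := Metric.eventually_nhds_iff.1 (Γ.eventually_mem_arc (e := e) hs₀ hδ)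
  refine ⟨ρ, hρ, fun ξ a b hab hξ hm hi => ?_⟩
  have hp : IntervalIntegrable (fun t => ⟪p, deriv ξ t⟫) volume a b := by
    refine (hξ.intervalIntegrable_norm_deriv.const_mul ‖p‖).mono_fun
      (measurable_const.inner (measurable_deriv ξ)).aestronglyMeasurable
      (Eventually.of_forall fun t => ?_)
    simp only [norm_mul, norm_norm]
    exact norm_inner_le_norm _ _
  have h2 := integral_mono_of_ae_Ioo hab (hp.sub (intervalIntegrable_const (c := κ))) hi (by
    filter_upwards [Γ.ae_isVelocity hξ fun t ht => (hm t ht).1] with t ht htm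
    obtain ⟨hc, hd⟩ := hm t (Ioo_subset_Icc_self htm)
    obtain ⟨s, hs, h3, h4⟩ := hρ' hd hc
    have h5 := (ht htm).2
    rw [← h4] at h5 ⊢
    have := H.le_lagrangian_arc c e hs p h5
    have h6 := hδ' (y := s) (by rwa [Real.dist_eq])
    linarith)
  rw [intervalIntegral.integral_sub hp intervalIntegrable_const, hξ.integral_inner_deriv,
    intervalIntegral.integral_const, smul_eq_mul] at h2
  linarith

variable {c} in
-- This is where the flux limiter inequality enters: `c x` is at least `a_γ`, hence at least the
-- infimum over `μ` at the endpoint `s = 1`.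
theorem exists_toFun_one_lt (hc : H.IsFluxLimiter c) {x : EuclideanSpace ℝ (Fin N)}
    (hx : x ∈ Γ.vertices) {ε : ℝ} (hε : 0 < ε) (e : ι) (he : Γ.arc e 1 = x) :
    ∃ μ, H.toFun e 1 μ < c x + ε := by
  have hl := hc x hx e he
  obtain ⟨M, -, hM⟩ := H.exists_abs_le 0
  obtain ⟨K, -, hK⟩ := H.exists_le_toFun 0
  have hbb : ∀ s ∈ Icc (0 : ℝ) 1, BddBelow (range (H.toFun e s)) := fun s hs => by
    refine ⟨-K, ?_⟩
    rintro _ ⟨μ, rfl⟩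
    have := hK e s hs μ
    linarith
  have hba : BddAbove (range fun s : Icc (0 : ℝ) 1 => ⨅ μ : ℝ, H.toFun e s μ) := by
    refine ⟨M, ?_⟩
    rintro _ ⟨s, rfl⟩
    exact (ciInf_le (hbb s s.2) 0).trans (abs_le.1 (hM e s s.2 0 (by simp))).2
  have h1 : ⨅ μ : ℝ, H.toFun e 1 μ ≤ H.arcLevel e := le_ciSup hba ⟨1, by simp⟩
  exact exists_lt_of_ciInf_lt (lt_of_le_of_lt (h1.trans hl) (by linarith))

variable {c} in
-- The function equal to `⟪p e, z - x⟫` on each arc `e` ending at `x` grows along a curve at a rate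
-- at most the Lagrangian plus `c x + ε`: on the arcs by Fenchel's inequality, at `x` because both
-- its derivative and the velocity vanish a.e. there. Being bounded by `K * dist z x`, it
-- contributes only the endpoint terms.
theorem exists_hasLocalBound_vertex (hc : H.IsFluxLimiter c) {x : EuclideanSpace ℝ (Fin N)}
    (hx : x ∈ Γ.vertices) {ε : ℝ} (hε : 0 < ε) :
    ∃ K : ℝ, H.HasLocalBound c x (fun z w => -(K * (dist z x + dist w x))) (c x + ε) := by
  classical
  have := Γ.finite
  have hex : ∀ e, ∃ p : EuclideanSpace ℝ (Fin N), Γ.arc e 1 = x →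
      H.toFun e 1 ⟪p, Γ.tangent e 1⟫ < c x + ε := fun e => by
    by_cases he : Γ.arc e 1 = x
    · obtain ⟨μ, hμ⟩ := H.exists_toFun_one_lt hc hx hε e he
      obtain ⟨p, hp⟩ := exists_inner_tangent_eq (Γ := Γ) e (s := 1) (by simp) μ
      exact ⟨p, fun _ => by rwa [hp]⟩
    · exact ⟨0, fun h => absurd h he⟩
  choose p hp using hex
  have hnear : ∀ᶠ s in 𝓝 (1 : ℝ), ∀ e, s ∈ Icc (0 : ℝ) 1 → Γ.arc e 1 = x →
      H.toFun e s ⟪p e, Γ.tangent e s⟫ < c x + ε := eventually_all.2 fun e => by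
    by_cases he : Γ.arc e 1 = x
    · filter_upwards [eventually_nhdsWithin_iff.1
        (H.eventually_toFun_inner_lt e (s₀ := 1) (by simp) (p e) (hp e he))] with s hs hs' _
      exact hs hs'
    · exact Eventually.of_forall fun s _ h => absurd h he
  obtain ⟨δ, hδ, hδ'⟩ := Metric.eventually_nhds_iff.1 hnear
  set η := min δ 1
  have hη : 0 < η := lt_min hδ one_pos
  obtain ⟨ρ, hρ, hρ'⟩ := Metric.eventually_nhds_iff.1 (Γ.eventually_param_near x hη)
  obtain ⟨K, hK, hKp⟩ := exists_forall_le_of_mono (ι := ι) (P := fun e K => ‖p e‖ ≤ K)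
    (fun e K K' h hK => le_trans hK h) fun e => ⟨_, le_rfl⟩
  set Q : ι → ℝ → Prop := fun e s => s ∈ Ioo (0 : ℝ) 1 ∧ Γ.arc e 1 = x ∧ |s - 1| < η
  -- Fixing the orientation towards `x` makes the arc through a point unique, since an arc and its
  -- inverse cannot both end at `x` when there are no loops.
  have huniq : ∀ e s e' s', Γ.arc e 1 = x → Γ.arc e' 1 = x →
      s ∈ Ioo (0 : ℝ) 1 → s' ∈ Ioo (0 : ℝ) 1 →
      Γ.arc e' s' = Γ.arc e s → e' = e := by
    intro e s e' s' h1 h2 hs hs' h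
    rcases Γ.eq_or_eq_rev_of_arc_eq hs (Ioo_subset_Icc_self hs') h with h3 | ⟨rfl, -⟩
    · exact h3.1
    · rw [Γ.arc_rev_one, ← h1] at h2
      exact absurd h2 (Γ.arc_zero_ne_arc_one e)
  have hcover : ∀ z ∈ Γ.carrier, dist z x < ρ → z ≠ x → ∃ e s, Q e s ∧ Γ.arc e s = z := by
    intro z hz hzρ hzx
    obtain ⟨e, s, hs, rfl⟩ := mem_iUnion.1 hz
    obtain ⟨s₁, hs₁, h1, h2⟩ := hρ' hzρ e s hs rfl
    have h3 : |s - s₁| < 1 := h2.trans_le (min_le_right _ _)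
    have hne : s ≠ s₁ := by rintro rfl; exact hzx h1
    have hs₁' : s₁ ∉ Ioo (0 : ℝ) 1 := fun h => Γ.arc_notMem_vertices h (h1 ▸ hx)
    rw [abs_lt] at h3
    rcases eq_or_lt_of_le hs₁.1 with rfl | h0
    · refine ⟨Γ.rev e, 1 - s, ⟨⟨by linarith, ?_⟩, by rw [Γ.arc_rev_one, h1], ?_⟩, ?_⟩
      · have := lt_of_le_of_ne hs.1 hne.symm
        linarith
      · rwa [sub_sub_cancel_left, abs_neg, ← sub_zero s]
      · rw [Γ.arc_rev e _ ⟨by linarith [hs.2], by linarith [hs.1]⟩, sub_sub_cancel]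
    · rcases eq_or_lt_of_le hs₁.2 with rfl | h0'
      · exact ⟨e, s, ⟨⟨by linarith, lt_of_le_of_ne hs.2 hne⟩, h1, h2⟩, rfl⟩
      · exact absurd ⟨h0, h0'⟩ hs₁'
  set F : EuclideanSpace ℝ (Fin N) → ℝ := fun z =>
    if h : ∃ e s, Q e s ∧ Γ.arc e s = z then ⟪p h.choose, z - x⟫ else 0 with hFdef
  have hF : ∀ e s, Q e s → F (Γ.arc e s) = ⟪p e, Γ.arc e s - x⟫ := by
    intro e s hQ
    have h : ∃ e' s', Q e' s' ∧ Γ.arc e' s' = Γ.arc e s := ⟨e, s, hQ, rfl⟩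
    obtain ⟨s', hQ', h'⟩ := h.choose_spec
    have heq : h.choose = e := huniq e s _ s' hQ.2.1 hQ'.2.1 hQ.1 hQ'.1 h'
    rw [hFdef]
    simp only
    rw [dif_pos h, heq]
  have hFK : ∀ z, |F z| ≤ K * dist z x := by
    intro z
    rw [hFdef]
    simp only
    split_ifs with h
    · rw [dist_eq_norm]
      exact (abs_real_inner_le_norm _ _).trans
        (mul_le_mul_of_nonneg_right (hKp _) (norm_nonneg _))
    · rw [abs_zero]; positivity
  have hFx : F x = 0 := by
    have := hFK x
    rw [dist_self, mul_zero] at this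
    exact abs_nonpos_iff.1 this
  refine ⟨K, ρ, hρ, fun ξ a b hab hξ hm hi => ?_⟩
  have hcont : ContinuousOn ξ (Icc a b) := by simpa [uIcc_of_le hab] using hξ.continuousOn
  have hn := hξ.intervalIntegrable_norm_deriv
  have hsubint : ∀ r ∈ Icc a b, ∀ s ∈ Icc a b, uIcc r s ⊆ uIcc a b := fun r hr s hs => by
    rw [uIcc_of_le hab]; exact uIcc_subset_Icc hr hs
  have hdist : ∀ r ∈ Icc a b, ∀ s ∈ Icc a b, r ≤ s →
      dist (ξ r) (ξ s) ≤ ∫ t in r..s, ‖deriv ξ t‖ := fun r hr s hs hrs =>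
    (hξ.mono (hsubint r hr s hs)).dist_le_integral hrs
  have hosc : ∀ r ∈ Icc a b, ∀ s ∈ Icc a b, r ≤ s →
      |F (ξ r) - F (ξ s)| ≤ K * ∫ t in r..s, ‖deriv ξ t‖ := by
    intro r hr s hs hrs
    -- The curve may visit `x` infinitely often and switch arcs there. If it meets `x` between `r`
    -- and `s`, both values of `F` are compared with `F x = 0`; otherwise it stays on a single arc,
    -- where `F` is linear.
    by_cases hux : ∃ u ∈ Icc r s, ξ u = x
    · obtain ⟨u, hu, hux⟩ := hux
      have huI : u ∈ Icc a b := ⟨hr.1.trans hu.1, hu.2.trans hs.2⟩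
      have h1 := hdist r hr u huI hu.1
      have h2 := hdist u huI s hs hu.2
      rw [hux] at h1 h2
      rw [← intervalIntegral.integral_add_adjacent_intervals
        (hn.mono_set (hsubint r hr u huI)) (hn.mono_set (hsubint u huI s hs)), mul_add]
      refine (abs_sub _ _).trans (add_le_add ((hFK _).trans ?_) ((hFK _).trans ?_))
      · exact mul_le_mul_of_nonneg_left h1 hK
      · rw [dist_comm]; exact mul_le_mul_of_nonneg_left h2 hK
    · push Not at hux
      have hI : ∀ u ∈ Icc r s, u ∈ Icc a b := fun u hu => ⟨hr.1.trans hu.1, hu.2.trans hs.2⟩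
      have hex : ∀ u : ℝ, ∃ e : ι, u ∈ Icc r s → ∃ σ, Q e σ ∧ Γ.arc e σ = ξ u := by
        intro u
        by_cases hu : u ∈ Icc r s
        · obtain ⟨e, σ, h⟩ := hcover (ξ u) (hm u (hI u hu)).1 (hm u (hI u hu)).2 (hux u hu)
          exact ⟨e, fun _ => ⟨σ, h⟩⟩
        · obtain ⟨e, -⟩ := mem_iUnion.1 (hm r hr).1
          exact ⟨e, fun h => absurd h hu⟩
      choose j hj using hex
      -- With the discrete topology on labels, local constancy of the arc label becomes continuity,
      -- and connectedness of `[r, s]` makes the label constant.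
      let _ : TopologicalSpace ι := ⊥
      have : DiscreteTopology ι := ⟨rfl⟩
      have hjc : ContinuousOn j (Icc r s) := by
        intro u hu
        rw [ContinuousWithinAt, nhds_discrete, tendsto_pure]
        obtain ⟨σ, hQ, hσ⟩ := hj u hu
        have h1 : ContinuousWithinAt ξ (Icc r s) u := (hcont u (hI u hu)).mono hI
        have h2 := Γ.eventually_mem_arc (e := j u) hQ.1 one_pos
        rw [hσ] at h2
        filter_upwards [h1.eventually h2, self_mem_nhdsWithin] with u' hu' hu'I
        obtain ⟨σ', hσ', -, h3⟩ := hu' (hm u' (hI u' hu'I)).1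
        obtain ⟨σ'', hQ'', h4⟩ := hj u' hu'I
        exact huniq (j u) σ' (j u') σ'' hQ.2.1 hQ''.2.1 hσ' hQ''.1 (h4.trans h3.symm)
      have hjrs : j r = j s := isPreconnected_Icc.constant hjc (left_mem_Icc.2 hrs) (right_mem_Icc.2 hrs)
      obtain ⟨σ, hQ, hσ⟩ := hj r (left_mem_Icc.2 hrs)
      obtain ⟨σ', hQ', hσ'⟩ := hj s (right_mem_Icc.2 hrs)
      rw [← hσ, ← hσ', hF _ _ hQ, hF _ _ hQ', hjrs, ← inner_sub_right, sub_sub_sub_cancel_right]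
      refine (abs_real_inner_le_norm _ _).trans
        (mul_le_mul (hKp _) ?_ (norm_nonneg _) hK)
      rw [← hjrs, hσ, hjrs, hσ', ← dist_eq_norm]
      exact hdist r hr s hs hrs
  have hac : AbsolutelyContinuousOnInterval (fun t => F (ξ t)) a b := by
    refine .of_dist_le ((hn.const_mul K).absolutelyContinuousOnInterval_intervalIntegral
      (c := a) left_mem_uIcc) fun r hr s hs => ?_
    rw [uIcc_of_le hab] at hr hs
    have hsub : ∀ r ∈ Icc a b, ∀ s ∈ Icc a b,
        (∫ t in a..s, K * ‖deriv ξ t‖) - ∫ t in a..r, K * ‖deriv ξ t‖ = K * ∫ t in r..s, ‖deriv ξ t‖ := by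
      intro r hr s hs
      have ha : a ∈ Icc a b := left_mem_Icc.2 hab
      rw [intervalIntegral.integral_interval_sub_left
        ((hn.const_mul K).mono_set (hsubint a ha s hs))
        ((hn.const_mul K).mono_set (hsubint a ha r hr)), intervalIntegral.integral_const_mul]
    rcases le_total r s with h | h
    · rw [dist_comm (∫ t in a..r, K * ‖deriv ξ t‖), Real.dist_eq, Real.dist_eq, hsub r hr s hs]
      exact (hosc r hr s hs h).trans (le_abs_self _)
    · rw [dist_comm, Real.dist_eq, Real.dist_eq, hsub s hs r hr]
      exact (hosc s hs r hr h).trans (le_abs_self _)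
  have h2 := integral_mono_of_ae_Ioo hab (hac.intervalIntegrable_deriv.sub
      (intervalIntegrable_const (c := c x + ε))) hi (by
    filter_upwards [Γ.ae_isVelocity hξ fun t ht => (hm t ht).1, hac.ae_differentiableAt,
      ae_hasDerivAt_eq_zero_of_eq (fun t => F (ξ t)) 0] with t ht hd h0 htm
    obtain ⟨hdξ, hvel⟩ := ht htm
    have hd' := (hd (Icc_subset_uIcc (Ioo_subset_Icc_self htm))).hasDerivAt
    -- At `x` the derivative of `F ∘ ξ` is zero by the level set lemma, and the inequality reduces
    -- to `-(c x + ε) ≤ -c x`.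
    by_cases hxt : ξ t = x
    · rw [h0 (by rw [hxt, hFx]) _ hd', hvel.2.1 (hxt ▸ hx), hxt, H.lagrangian_vertex c hx]
      linarith
    · obtain ⟨e, s, hQ, hs⟩ := hcover (ξ t) (hm t (Ioo_subset_Icc_self htm)).1
        (hm t (Ioo_subset_Icc_self htm)).2 hxt
      have h3 := Γ.eventually_mem_arc (e := e) hQ.1 (sub_pos.2 hQ.2.2)
      rw [hs] at h3
      have hev : (fun r => F (ξ r)) =ᶠ[𝓝 t] fun r => ⟪p e, ξ r - x⟫ := by
        filter_upwards [hdξ.continuousAt.eventually h3, Icc_mem_nhds htm.1 htm.2] with r hr hrI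
        obtain ⟨s', hs', h4, h5⟩ := hr (hm r hrI).1
        rw [← h5, hF e s' ⟨hs', hQ.2.1, ?_⟩]
        have := abs_sub_le s' s 1
        linarith
      have hd2 : HasDerivAt (fun r => ⟪p e, ξ r - x⟫) ⟪p e, deriv ξ t⟫ t := by
        simpa using (hasDerivAt_const t (p e)).inner ℝ (hdξ.sub_const x)
      rw [(hd2.congr_of_eventuallyEq hev).deriv]
      have hlt := hδ' (y := s) (by rw [Real.dist_eq]; exact hQ.2.2.trans_le (min_le_left _ _)) e
        (Ioo_subset_Icc_self hQ.1) hQ.2.1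
      rw [← hs] at hvel ⊢
      have := H.le_lagrangian_arc c e hQ.1 (p e) hvel
      linarith)
  rw [intervalIntegral.integral_sub hac.intervalIntegrable_deriv intervalIntegrable_const,
    hac.integral_deriv_eq_sub, intervalIntegral.integral_const, smul_eq_mul] at h2
  have ha := (abs_le.1 (hFK (ξ a))).2
  have hb := (abs_le.1 (hFK (ξ b))).1
  simp only [mul_add]
  linarith

end Hamiltonian

end EmbeddedNetwork

/-! ### Lower semicontinuity and existence of minimizers. -/

namespace EmbeddedNetwork

namespace Hamiltonian

variable {N : ℕ} {ι : Type*} {Γ : EmbeddedNetwork N ι} (H : Γ.Hamiltonian)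
  (c : EuclideanSpace ℝ (Fin N) → ℝ)

theorem le_of_hasDerivAt_of_eventually_le {B ψ : ℝ → ℝ} {β m κ t : ℝ} (hB : HasDerivAt B β t)
    (hψ : HasDerivAt ψ m t) (hψt : ψ t = 0)
    (h : ∀ᶠ s in 𝓝[>] t, ψ s - κ * (s - t) ≤ B s - B t) : m - κ ≤ β := by
  have hsub : ∀ {f : ℝ → ℝ} {d : ℝ}, HasDerivAt f d t → Tendsto (slope f t) (𝓝[>] t) (𝓝 d) :=
    fun hf => (hasDerivAt_iff_tendsto_slope.1 hf).mono_left
      (nhdsWithin_mono _ fun s hs => ne_of_gt hs)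
  refine le_of_tendsto_of_tendsto ((hsub hψ).sub_const κ) (hsub hB) ?_
  filter_upwards [h, self_mem_nhdsWithin] with s hs hst
  have hst' : 0 < s - t := sub_pos.2 hst
  rw [slope_def_field, slope_def_field, hψt, sub_zero, le_div_iff₀ hst', sub_mul,
    div_mul_cancel₀ _ hst'.ne']
  exact hs

variable {c} in
-- Differentiating the endpoint bounds at `t`: inside an arc they give `v * μ - H - ε ≤ β` for every
-- `μ`, whose supremum is the Lagrangian. At a vertex the velocity is zero, so the distance terms
-- are `o(s - t)` and only `-(c x + ε)` is left.
theorem lagrangian_le_of_hasLocalBound (hc : H.IsFluxLimiter c) {ξ : ℝ → EuclideanSpace ℝ (Fin N)}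
    {q : EuclideanSpace ℝ (Fin N)} {t β : ℝ} {B : ℝ → ℝ} (hξ : HasDerivAt ξ q t)
    (hv : Γ.IsVelocity (ξ t) q) (hB : HasDerivAt B β t)
    (h : ∀ Φ κ, Continuous (Function.uncurry Φ) → H.HasLocalBound c (ξ t) Φ κ →
      ∀ᶠ s in 𝓝[>] t, Φ (ξ t) (ξ s) - κ * (s - t) ≤ B s - B t) :
    H.lagrangian c (ξ t) q ≤ β := by
  by_cases hx : ξ t ∈ Γ.vertices
  · have hq := hv.2.1 hx
    subst hq
    rw [H.lagrangian_vertex c hx]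
    refine le_of_forall_pos_le_add fun ε hε => ?_
    obtain ⟨K, hK⟩ := H.exists_hasLocalBound_vertex hc hx hε
    have h0 : HasDerivAt (fun s => dist (ξ s) (ξ t)) 0 t := by
      rw [hasDerivAt_iff_isLittleO] at hξ ⊢
      simpa [dist_eq_norm] using hξ.norm_left
    have h1 : HasDerivAt (fun s => -(K * (dist (ξ t) (ξ t) + dist (ξ s) (ξ t)))) 0 t := by
      have := ((h0.const_add (dist (ξ t) (ξ t))).const_mul K).neg
      rwa [mul_zero, neg_zero] at this
    have h2 := le_of_hasDerivAt_of_eventually_le hB h1 (by simp)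
      (h (fun z w => -(K * (dist z (ξ t) + dist w (ξ t)))) _ (by fun_prop) hK)
    linarith
  · obtain ⟨e, s, hs, hes⟩ := Γ.exists_arc_of_notMem_vertices hv.1 hx
    obtain ⟨v, rfl⟩ := hv.2.2 e s hs hes
    rw [← hes, H.lagrangian_arc_smul c e hs]
    refine ciSup_le fun μ => le_of_forall_pos_le_add fun ε hε => ?_
    obtain ⟨p, hp⟩ := exists_inner_tangent_eq (Γ := Γ) e (Ioo_subset_Icc_self hs) μ
    have hK := H.hasLocalBound_arc c e hs p (κ := H.toFun e s μ + ε) (by rw [hp]; linarith)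
    rw [hes] at hK
    have h1 : HasDerivAt (fun r => ⟪p, ξ r - ξ t⟫) (v * μ) t := by
      have := (hasDerivAt_const t p).inner ℝ (hξ.sub_const (ξ t))
      rw [real_inner_smul_right, hp] at this
      simpa using this
    have h2 := le_of_hasDerivAt_of_eventually_le hB h1 (by simp)
      (h (fun z w => ⟪p, w - z⟫) _ (by fun_prop) hK)
    linarith

theorem mul_dist_le_action {R M : ℝ} (hR : 0 ≤ R)
    (h : ∀ z q, Γ.IsVelocity z q → R * ‖q‖ - M ≤ H.lagrangian c z q)
    {ξ : ℝ → EuclideanSpace ℝ (Fin N)} {a b : ℝ} (hab : a ≤ b)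
    (hξ : AbsolutelyContinuousOnInterval ξ a b) (hm : MapsTo ξ (Icc a b) Γ.carrier)
    (hi : IntervalIntegrable (fun t => H.lagrangian c (ξ t) (deriv ξ t)) volume a b) :
    R * (∫ t in a..b, ‖deriv ξ t‖) ≤
      (∫ t in a..b, H.lagrangian c (ξ t) (deriv ξ t)) + M * (b - a) ∧
    R * dist (ξ a) (ξ b) ≤ (∫ t in a..b, H.lagrangian c (ξ t) (deriv ξ t)) + M * (b - a) := by
  have hn := hξ.intervalIntegrable_norm_deriv
  have h1 := integral_mono_of_ae_Ioo hab ((hn.const_mul R).sub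
    (intervalIntegrable_const (c := M))) hi (by
      filter_upwards [Γ.ae_isVelocity hξ hm] with t ht htm using h _ _ (ht htm).2)
  rw [intervalIntegral.integral_sub (hn.const_mul R) intervalIntegrable_const,
    intervalIntegral.integral_const_mul, intervalIntegral.integral_const, smul_eq_mul] at h1
  have h2 := mul_le_mul_of_nonneg_left (hξ.dist_le_integral hab) hR
  constructor <;> linarith

theorem isCurve_sub {T : ℝ} {ξ : ℝ → EuclideanSpace ℝ (Fin N)} {y x : EuclideanSpace ℝ (Fin N)}
    (h : Γ.IsCurve T ξ y x) {s t : ℝ} (hs : s ∈ Icc 0 T) (ht : t ∈ Icc 0 T) :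
    AbsolutelyContinuousOnInterval ξ s t ∧ MapsTo ξ (Icc s t) Γ.carrier := by
  refine ⟨h.absolutelyContinuous.mono ?_, fun r hr => h.mapsTo ⟨hs.1.trans hr.1, hr.2.trans ht.2⟩⟩
  rw [uIcc_of_le (hs.1.trans hs.2)]
  exact uIcc_subset_Icc hs ht

theorem exists_le_of_mem_actions : ∃ M, 0 ≤ M ∧ ∀ y x T, 0 ≤ T → ∀ A ∈ H.actions c y x T,
    -(M * T) ≤ A := by
  obtain ⟨M, hM, hM'⟩ := H.exists_le_lagrangian c 0
  refine ⟨M, hM, fun y x T hT A hA => ?_⟩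
  obtain ⟨ξ, hξ, hi, rfl⟩ := hA
  have := (H.mul_dist_le_action c le_rfl hM' hT hξ.absolutelyContinuous hξ.mapsTo hi).2
  linarith

theorem bddBelow_actions (y x : EuclideanSpace ℝ (Fin N)) {T : ℝ} (hT : 0 ≤ T) :
    BddBelow (H.actions c y x T) := by
  obtain ⟨M, -, hM⟩ := H.exists_le_of_mem_actions c
  exact ⟨-(M * T), fun A hA => hM y x T hT A hA⟩

variable {c} in
/-- Existence of minimizers. -/
theorem isLeast_minAction (hc : H.IsFluxLimiter c) {y x : EuclideanSpace ℝ (Fin N)} {T : ℝ}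
    (hT : 0 ≤ T) (hne : (H.actions c y x T).Nonempty) :
    IsLeast (H.actions c y x T) (H.minAction c y x T) := by
  have hbb := H.bddBelow_actions c y x hT
  suffices h : ∃ A ∈ H.actions c y x T, A ≤ sInf (H.actions c y x T) by
    obtain ⟨A, hA, hle⟩ := h
    have : A = H.minAction c y x T := le_antisymm hle (csInf_le hbb hA)
    exact ⟨this ▸ hA, fun B hB => csInf_le hbb hB⟩
  obtain ⟨A, hAanti, hAlim, hAmem⟩ := exists_seq_tendsto_sInf hne hbb
  choose ξ hξ hgi hA using hAmem
  obtain ⟨M₀, hM₀, hM₀'⟩ := H.exists_le_lagrangian c 1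
  have h0T : (0 : ℝ) ∈ Icc 0 T := left_mem_Icc.2 hT
  have hTT : T ∈ Icc 0 T := right_mem_Icc.2 hT
  set g : ℕ → ℝ → ℝ := fun n t => H.lagrangian c (ξ n t) (deriv (ξ n) t)
  have hsub : ∀ n, ∀ s ∈ Icc 0 T, ∀ t ∈ Icc 0 T, IntervalIntegrable (g n) volume s t :=
    fun n s hs t ht => (hgi n).mono_set (by rw [uIcc_of_le hT]; exact uIcc_subset_Icc hs ht)
  -- Running actions, made nondecreasing by the lower bound `-M₀` of the Lagrangian.
  set a : ℕ → ℝ → ℝ := fun n t => (∫ r in (0 : ℝ)..t, g n r) + M₀ * t with ha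
  have hinc : ∀ n, ∀ s ∈ Icc 0 T, ∀ t ∈ Icc 0 T,
      a n t - a n s = (∫ r in s..t, g n r) + M₀ * (t - s) := by
    intro n s hs t ht
    have := intervalIntegral.integral_interval_sub_left (hsub n 0 h0T t ht) (hsub n 0 h0T s hs)
    simp only [ha]
    rw [← this]; ring
  have hmod : ∀ R > (0 : ℝ), ∃ M : ℝ, ∀ n, ∀ s ∈ Icc 0 T, ∀ t ∈ Icc 0 T, s ≤ t →
      R * dist (ξ n s) (ξ n t) ≤ a n t - a n s + M * (t - s) := by
    intro R hR
    obtain ⟨M, -, hM'⟩ := H.exists_le_lagrangian c R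
    refine ⟨M - M₀, fun n s hs t ht hst => ?_⟩
    obtain ⟨h1, h2⟩ := isCurve_sub (hξ n) hs ht
    have := (H.mul_dist_le_action c hR.le hM' hst h1 h2 (hsub n s hs t ht)).2
    rw [hinc n s hs t ht]
    linarith
  have hmono : ∀ n, ∀ s ∈ Icc 0 T, ∀ t ∈ Icc 0 T, s ≤ t → a n s ≤ a n t := by
    intro n s hs t ht hst
    obtain ⟨h1, h2⟩ := isCurve_sub (hξ n) hs ht
    have h3 := (H.mul_dist_le_action c zero_le_one hM₀' hst h1 h2 (hsub n s hs t ht)).2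
    have h4 := hinc n s hs t ht
    have : 0 ≤ 1 * dist (ξ n s) (ξ n t) := by positivity
    linarith
  have ha0 : ∀ n, a n 0 = 0 := fun n => by simp [ha]
  have haT : ∀ n, a n T = A n + M₀ * T := fun n => by simp only [ha]; rw [hA n]
  set L := A 0 + M₀ * T
  have haI : ∀ n, ∀ t ∈ Icc 0 T, a n t ∈ Icc 0 L := fun n t ht =>
    ⟨(ha0 n) ▸ hmono n 0 h0T t ht ht.1, (hmono n t ht T hTT ht.2).trans (by
      rw [haT]; exact add_le_add_left (hAanti (Nat.zero_le n)) _)⟩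
  -- The ultrafilter gives limits of curves and running actions at all times simultaneously, without
  -- extracting subsequences.
  have hexξ : ∀ t, ∃ l, t ∈ Icc 0 T → l ∈ Γ.carrier ∧
      Tendsto (fun n => ξ n t) (hyperfilter ℕ : Filter ℕ) (𝓝 l) := fun t => by
    by_cases ht : t ∈ Icc 0 T
    · obtain ⟨l, hl, hl'⟩ := (hyperfilter ℕ).exists_tendsto_of_mem Γ.isCompact_carrier
        (f := fun n => ξ n t) fun n => (hξ n).mapsTo ht
      exact ⟨l, fun _ => ⟨hl, hl'⟩⟩
    · exact ⟨0, fun h => absurd h ht⟩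
  have hexα : ∀ t, ∃ l, t ∈ Icc 0 T →
      Tendsto (fun n => a n t) (hyperfilter ℕ : Filter ℕ) (𝓝 l) := fun t => by
    by_cases ht : t ∈ Icc 0 T
    · obtain ⟨l, hl, hl'⟩ := (hyperfilter ℕ).exists_tendsto_of_mem isCompact_Icc
        (f := fun n => a n t) fun n => haI n t ht
      exact ⟨l, fun _ => hl'⟩
    · exact ⟨0, fun h => absurd h ht⟩
  choose ζ hζ using hexξ
  choose α hα using hexα
  have hαmono : MonotoneOn α (Icc 0 T) := fun s hs t ht hst =>
    le_of_tendsto_of_tendsto' (hα s hs) (hα t ht) fun n => hmono n s hs t ht hst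
  have hζmod : ∀ R > (0 : ℝ), ∃ M : ℝ, ∀ s ∈ Icc 0 T, ∀ t ∈ Icc 0 T, s ≤ t →
      R * dist (ζ s) (ζ t) ≤ α t - α s + M * (t - s) := by
    intro R hR
    obtain ⟨M, hM⟩ := hmod R hR
    exact ⟨M, fun s hs t ht hst => le_of_tendsto_of_tendsto'
      (((hζ s hs).2.dist (hζ t ht).2).const_mul R) (((hα t ht).sub (hα s hs)).add_const _)
      fun n => hM n s hs t ht hst⟩
  have hζac := AbsolutelyContinuousOnInterval.of_modulus hT hαmono hζmod
  have hζm : MapsTo ζ (Icc 0 T) Γ.carrier := fun t ht => (hζ t ht).1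
  have hcurve : Γ.IsCurve T ζ y x := by
    refine ⟨hζac, hζm, tendsto_nhds_unique (hζ 0 h0T).2 ?_, tendsto_nhds_unique (hζ T hTT).2 ?_⟩
    · simp [(hξ _).source]
    · simp [(hξ _).target]
  have hα0 : α 0 = 0 := tendsto_nhds_unique (hα 0 h0T) (by simp [ha0])
  have hαT : α T = sInf (H.actions c y x T) + M₀ * T := by
    refine tendsto_nhds_unique (hα T hTT) ?_
    simp only [haT]
    exact (hAlim.mono_left Nat.hyperfilter_le_atTop).add_const _
  have hlow : ∀ z q, Γ.IsVelocity z q → -M₀ ≤ H.lagrangian c z q := fun z q h => by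
    have := hM₀' z q h
    linarith [norm_nonneg q]
  -- The limit `α` of the running actions may jump, but only its a.e. derivative is compared with
  -- the Lagrangian, and the total increment is the infimum.
  obtain ⟨hint, hle⟩ := intervalIntegrable_and_integral_le_of_le_deriv
    (B := fun t => α t - M₀ * t) (k := M₀) (M := M₀) hT (by simpa using hαmono)
    (H.aemeasurable_lagrangian c hT hζac hζm).aestronglyMeasurable (by
      filter_upwards [Γ.ae_isVelocity hζac hζm] with t ht htm β hβ
      obtain ⟨hd, hv⟩ := ht htm
      refine ⟨hlow _ _ hv, H.lagrangian_le_of_hasLocalBound hc hd hv hβ fun Φ κ hΦ hb => ?_⟩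
      obtain ⟨ρ, hρ, hb⟩ := hb
      have htI := Ioo_subset_Icc_self htm
      -- For this slope and times within `1 / (|M| + 1)` of `t`, the modulus is at most `L + 1`,
      -- which forces distances below `ρ / 2`. As `M` does not depend on `n`, all curves stay near
      -- their position at `t` on a common interval, so the local bound applies to them.
      obtain ⟨M, hM⟩ := hmod (4 * (L + 1) / ρ) (div_pos (by
        have := (haI 0 T hTT).1.trans (haI 0 T hTT).2
        linarith) hρ)
      have hδ : 0 < 1 / (|M| + 1) := by positivity
      filter_upwards [Ioo_mem_nhdsGT htm.2, Ioo_mem_nhdsGT (lt_add_of_pos_right t hδ)] with s hs hs'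
      have hsI : s ∈ Icc 0 T := ⟨htI.1.trans hs.1.le, hs.2.le⟩
      have hclose : ∀ n, ∀ r ∈ Icc t s, dist (ξ n t) (ξ n r) < ρ / 2 := by
        intro n r hr
        have hrI : r ∈ Icc 0 T := ⟨htI.1.trans hr.1, hr.2.trans hsI.2⟩
        have h1 := hM n t htI r hrI hr.1
        have h2 := (haI n r hrI).2
        have h3 := (haI n t htI).1
        have h4 : M * (r - t) ≤ 1 := by
          calc M * (r - t) ≤ |M| * (1 / (|M| + 1)) := by
                refine mul_le_mul (le_abs_self M) ?_ (sub_nonneg.2 hr.1) (abs_nonneg M)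
                linarith [hr.2, hs'.2]
            _ ≤ 1 := by rw [mul_one_div, div_le_one (by positivity)]; linarith
        have hL : 0 ≤ L := h3.trans (haI n t htI).2
        by_contra hcon
        push Not at hcon
        have h5 : 4 * (L + 1) / ρ * (ρ / 2) ≤ 4 * (L + 1) / ρ * dist (ξ n t) (ξ n r) :=
          mul_le_mul_of_nonneg_left hcon (by positivity)
        have h6 : 4 * (L + 1) / ρ * (ρ / 2) = 2 * (L + 1) := by field_simp; ring
        linarith
      have hlim : Tendsto (fun n => Φ (ξ n t) (ξ n s) - κ * (s - t)) (hyperfilter ℕ : Filter ℕ)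
          (𝓝 (Φ (ζ t) (ζ s) - κ * (s - t))) :=
        ((hΦ.tendsto (ζ t, ζ s)).comp ((hζ t htI).2.prodMk_nhds (hζ s hsI).2)).sub_const _
      have hlim' : Tendsto (fun n => ∫ r in t..s, g n r) (hyperfilter ℕ : Filter ℕ)
          (𝓝 (α s - M₀ * s - (α t - M₀ * t))) := by
        have := ((hα s hsI).sub (hα t htI)).sub_const (M₀ * (s - t))
        rw [show α s - M₀ * s - (α t - M₀ * t) = α s - α t - M₀ * (s - t) by ring]
        refine this.congr fun n => ?_
        rw [hinc n t htI s hsI]; ring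
      refine le_of_tendsto_of_tendsto hlim hlim' ?_
      filter_upwards [(hζ t htI).2.eventually (Metric.ball_mem_nhds _ (half_pos hρ))] with n hn
      obtain ⟨h1, h2⟩ := isCurve_sub (hξ n) htI hsI
      refine hb (ξ n) t s hs.1.le h1 (fun r hr => ⟨h2 hr, ?_⟩) (hsub n t htI s hsI)
      have h3 := dist_triangle_left (ξ n r) (ζ t) (ξ n t)
      have h4 := hclose n r hr
      linarith)
  refine ⟨_, ⟨ζ, hcurve, hint, rfl⟩, hle.trans ?_⟩
  simp only [hα0, hαT]
  linarith

end Hamiltonian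

end EmbeddedNetwork

/-! ### Concatenation, geodesic distance and curves of bounded speed. -/

namespace AbsolutelyContinuousOnInterval

theorem congr {X : Type*} [PseudoMetricSpace X] {f g : ℝ → X} {a b : ℝ}
    (hf : AbsolutelyContinuousOnInterval f a b) (h : EqOn g f (uIcc a b)) :
    AbsolutelyContinuousOnInterval g a b :=
  hf.of_dist_le fun s hs t ht => by rw [h hs, h ht]

/-- Increments, including those across `b`, are dominated by those of the primitive of the speed,
which is absolutely continuous on the whole interval. -/
theorem trans {N : ℕ} {f : ℝ → EuclideanSpace ℝ (Fin N)} {a b c : ℝ} (hab : a ≤ b) (hbc : b ≤ c)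
    (h₁ : AbsolutelyContinuousOnInterval f a b) (h₂ : AbsolutelyContinuousOnInterval f b c) :
    AbsolutelyContinuousOnInterval f a c := by
  have hi₁ := h₁.intervalIntegrable_norm_deriv
  have hi₂ := h₂.intervalIntegrable_norm_deriv
  have hi := hi₁.trans hi₂
  have hac := hab.trans hbc
  have hsub : ∀ s ∈ Icc a c, ∀ t ∈ Icc a c, IntervalIntegrable (fun t => ‖deriv f t‖) volume s t :=
    fun s hs t ht => hi.mono_set (by rw [uIcc_of_le hac]; exact uIcc_subset_Icc hs ht)
  have hd : ∀ s ∈ Icc a c, ∀ t ∈ Icc a c, s ≤ t → dist (f s) (f t) ≤ ∫ r in s..t, ‖deriv f r‖ := by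
    intro s hs t ht hst
    rcases le_total t b with htb | htb
    · refine (h₁.mono ?_).dist_le_integral hst
      rw [uIcc_of_le hab]
      exact uIcc_subset_Icc ⟨hs.1, hst.trans htb⟩ ⟨ht.1, htb⟩
    rcases le_total b s with hbs | hbs
    · refine (h₂.mono ?_).dist_le_integral hst
      rw [uIcc_of_le hbc]
      exact uIcc_subset_Icc ⟨hbs, hs.2⟩ ⟨htb, ht.2⟩
    have hb : b ∈ Icc a c := ⟨hab, hbc⟩
    rw [← intervalIntegral.integral_add_adjacent_intervals (hsub s hs b hb) (hsub b hb t ht)]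
    refine (dist_triangle _ (f b) _).trans (add_le_add ?_ ?_)
    · refine (h₁.mono ?_).dist_le_integral hbs
      rw [uIcc_of_le hab]
      exact uIcc_subset_Icc ⟨hs.1, hbs⟩ (right_mem_Icc.2 hab)
    · refine (h₂.mono ?_).dist_le_integral htb
      rw [uIcc_of_le hbc]
      exact uIcc_subset_Icc (left_mem_Icc.2 hbc) ⟨htb, ht.2⟩
  refine .of_dist_le (hi.absolutelyContinuousOnInterval_intervalIntegral (c := a) left_mem_uIcc)
    fun s hs t ht => ?_
  rw [uIcc_of_le hac] at hs ht
  have ha : a ∈ Icc a c := left_mem_Icc.2 hac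
  rcases le_total s t with h | h
  · rw [dist_comm (∫ r in a..s, _), Real.dist_eq,
      intervalIntegral.integral_interval_sub_left (hsub a ha t ht) (hsub a ha s hs)]
    exact (hd s hs t ht h).trans (le_abs_self _)
  · rw [dist_comm (f s), Real.dist_eq,
      intervalIntegral.integral_interval_sub_left (hsub a ha s hs) (hsub a ha t ht)]
    exact (hd t ht s hs h).trans (le_abs_self _)

end AbsolutelyContinuousOnInterval

namespace EmbeddedNetwork

variable {N : ℕ} {ι : Type*} {Γ : EmbeddedNetwork N ι}

/-- The concatenation of a curve on `[0, S]` with another curve. -/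
noncomputable def concat (S : ℝ) (ξ ζ : ℝ → EuclideanSpace ℝ (Fin N)) (t : ℝ) :
    EuclideanSpace ℝ (Fin N) :=
  if t ≤ S then ξ t else ζ (t - S)

theorem concat_of_le {S t : ℝ} (ξ ζ : ℝ → EuclideanSpace ℝ (Fin N)) (h : t ≤ S) :
    concat S ξ ζ t = ξ t := if_pos h

theorem concat_of_ge {S t : ℝ} {ξ ζ : ℝ → EuclideanSpace ℝ (Fin N)} (h0 : ξ S = ζ 0) (h : S ≤ t) :
    concat S ξ ζ t = ζ (t - S) := by
  rcases h.eq_or_lt with rfl | h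
  · rw [concat_of_le _ _ le_rfl, sub_self, h0]
  · exact if_neg h.not_ge

theorem IsCurve.concat {S T : ℝ} {ξ ζ : ℝ → EuclideanSpace ℝ (Fin N)}
    {y z x : EuclideanSpace ℝ (Fin N)} (hS : 0 ≤ S) (hT : 0 ≤ T)
    (hξ : Γ.IsCurve S ξ y z) (hζ : Γ.IsCurve T ζ z x) :
    Γ.IsCurve (S + T) (concat S ξ ζ) y x := by
  have h0 : ξ S = ζ 0 := hξ.target.trans hζ.source.symm
  have hST : S ≤ S + T := by linarith
  refine ⟨.trans hS hST (hξ.absolutelyContinuous.congr fun t ht => ?_)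
    (AbsolutelyContinuousOnInterval.congr (f := fun t => ζ (t - S)) ?_ fun t ht => ?_),
    fun t ht => ?_, ?_, ?_⟩
  · rw [uIcc_of_le hS] at ht
    exact concat_of_le _ _ ht.2
  · refine hζ.absolutelyContinuous.comp_monotoneOn (φ := fun t => t - S)
      (fun s _ t _ hst => sub_le_sub_right hst S) ?_ ?_
    · rw [uIcc_of_le hST, uIcc_of_le hT]
      exact fun t ht => ⟨sub_nonneg.2 ht.1, by linarith [ht.2]⟩
    · refine LipschitzOnWith.absolutelyContinuousOnInterval (K := 1) ?_
      exact LipschitzOnWith.of_dist_le_mul fun s _ t _ => by simp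
  · rw [uIcc_of_le hST] at ht
    exact concat_of_ge h0 ht.1
  · rcases le_total t S with h | h
    · rw [concat_of_le _ _ h]; exact hξ.mapsTo ⟨ht.1, h⟩
    · rw [concat_of_ge h0 h]; exact hζ.mapsTo ⟨sub_nonneg.2 h, by linarith [ht.2]⟩
  · rw [concat_of_le _ _ hS, hξ.source]
  · rw [concat_of_ge h0 hST, add_sub_cancel_left, hζ.target]

theorem deriv_concat_of_lt {S t : ℝ} (ξ ζ : ℝ → EuclideanSpace ℝ (Fin N)) (h : t < S) :
    deriv (concat S ξ ζ) t = deriv ξ t := by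
  refine EventuallyEq.deriv_eq ?_
  filter_upwards [gt_mem_nhds h] with r hr using concat_of_le _ _ (le_of_lt hr)

theorem deriv_concat_of_gt {S t : ℝ} {ξ ζ : ℝ → EuclideanSpace ℝ (Fin N)} (h0 : ξ S = ζ 0)
    (h : S < t) : deriv (concat S ξ ζ) t = deriv ζ (t - S) := by
  rw [← deriv_comp_sub_const]
  refine EventuallyEq.deriv_eq ?_
  filter_upwards [lt_mem_nhds h] with r hr using concat_of_ge h0 (le_of_lt hr)

theorem isCurve_arc (e : ι) {s s' : ℝ} (hs : 0 ≤ s) (hss : s ≤ s') (hs' : s' ≤ 1) :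
    Γ.IsCurve (s' - s) (fun t => Γ.arc e (s + t)) (Γ.arc e s) (Γ.arc e s') := by
  have hmaps : ∀ t ∈ Icc 0 (s' - s), s + t ∈ Icc (0 : ℝ) 1 := fun t ht =>
    ⟨by linarith [ht.1], by linarith [ht.2]⟩
  refine ⟨?_, fun t ht => Γ.arc_mem_carrier e (hmaps t ht), by simp, by simp⟩
  have h1 : AbsolutelyContinuousOnInterval (Γ.arc e) 0 1 :=
    ContDiffOn.absolutelyContinuousOnInterval (by
      rw [uIcc_of_le zero_le_one]; exact Γ.contDiffOn_arc e)
  refine h1.comp_monotoneOn (φ := fun t => s + t) (fun r _ t _ hrt => add_le_add_right hrt s) ?_ ?_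
  · rw [uIcc_of_le (sub_nonneg.2 hss), uIcc_of_le zero_le_one]
    exact hmaps
  · refine LipschitzOnWith.absolutelyContinuousOnInterval (K := 1) ?_
    exact LipschitzOnWith.of_dist_le_mul fun s _ t _ => by simp

variable (Γ) in
theorem exists_isCurve {y x : EuclideanSpace ℝ (Fin N)} (hy : y ∈ Γ.carrier) (hx : x ∈ Γ.carrier) :
    ∃ ξ, Γ.IsCurve 1 ξ y x := by
  let J : EuclideanSpace ℝ (Fin N) → EuclideanSpace ℝ (Fin N) → Prop := fun y x =>
    ∃ T, 0 ≤ T ∧ ∃ ξ, Γ.IsCurve T ξ y x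
  have htrans : ∀ {a b d}, J a b → J b d → J a d := by
    rintro a b d ⟨S, hS, ξ, hξ⟩ ⟨T, hT, ζ, hζ⟩
    exact ⟨S + T, add_nonneg hS hT, _, hξ.concat hS hT hζ⟩
  have harc : ∀ e s s', 0 ≤ s → s ≤ s' → s' ≤ 1 → J (Γ.arc e s) (Γ.arc e s') :=
    fun e s s' hs hss hs' => ⟨_, sub_nonneg.2 hss, _, isCurve_arc e hs hss hs'⟩
  obtain ⟨e, s, hs, rfl⟩ := mem_iUnion.1 hy
  obtain ⟨e', s', hs', rfl⟩ := mem_iUnion.1 hx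
  have hchain : J (Γ.arc e 1) (Γ.arc e' 0) := by
    have h := Γ.connected (Γ.arc e 1) (Or.inr ⟨e, rfl⟩) (Γ.arc e' 0) (Or.inl ⟨e', rfl⟩)
    generalize Γ.arc e' 0 = w at h
    induction h with
    | refl => simpa using harc e 1 1 zero_le_one le_rfl le_rfl
    | tail _ h ih =>
      obtain ⟨e'', rfl, rfl⟩ := h
      exact htrans ih (harc e'' 0 1 le_rfl zero_le_one le_rfl)
  obtain ⟨T, hT, ξ, hξ⟩ := htrans (htrans (harc e s 1 hs.1 hs.2 le_rfl) hchain)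
    (harc e' 0 s' le_rfl hs'.1 hs'.2)
  have hmaps : ∀ t ∈ Icc (0 : ℝ) 1, T * t ∈ Icc 0 T := fun t ht =>
    ⟨mul_nonneg hT ht.1, mul_le_of_le_one_right hT ht.2⟩
  refine ⟨fun t => ξ (T * t), ?_, fun t ht => hξ.mapsTo (hmaps t ht), ?_, ?_⟩
  · refine hξ.absolutelyContinuous.comp_monotoneOn (φ := fun t => T * t)
      (fun r _ t _ hrt => mul_le_mul_of_nonneg_left hrt hT) ?_ ?_
    · rwa [uIcc_of_le zero_le_one, uIcc_of_le hT]
    · refine LipschitzOnWith.absolutelyContinuousOnInterval (K := T.toNNReal) ?_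
      refine LipschitzOnWith.of_dist_le_mul fun s _ t _ => ?_
      rw [Real.dist_eq, ← mul_sub, abs_mul, abs_of_nonneg hT, Real.coe_toNNReal _ hT, Real.dist_eq]
  · simpa using hξ.source
  · simpa using hξ.target

/-- Finiteness ensures that `toReal` in `geodesicDist` returns the actual infimum and not the
default value `0` of `⊤`. -/
theorem iInf_eVariationOn_ne_top {y x : EuclideanSpace ℝ (Fin N)} (hy : y ∈ Γ.carrier)
    (hx : x ∈ Γ.carrier) : (⨅ (ξ : ℝ → EuclideanSpace ℝ (Fin N)) (_ : Γ.IsCurve 1 ξ y x),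
      eVariationOn ξ (Icc 0 1)) ≠ ⊤ := by
  obtain ⟨ξ, hξ⟩ := Γ.exists_isCurve hy hx
  refine ne_top_of_le_ne_top ?_ (iInf₂_le ξ hξ)
  have := hξ.absolutelyContinuous.boundedVariationOn
  rwa [uIcc_of_le zero_le_one] at this

theorem geodesicDist_nonneg (y x : EuclideanSpace ℝ (Fin N)) : 0 ≤ Γ.geodesicDist y x :=
  ENNReal.toReal_nonneg

theorem dist_le_geodesicDist {y x : EuclideanSpace ℝ (Fin N)} (hy : y ∈ Γ.carrier)
    (hx : x ∈ Γ.carrier) : dist y x ≤ Γ.geodesicDist y x := by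
  rw [geodesicDist, ← ENNReal.ofReal_le_iff_le_toReal (iInf_eVariationOn_ne_top hy hx), ← edist_dist]
  refine le_iInf₂ fun ξ hξ => ?_
  have := eVariationOn.edist_le ξ (left_mem_Icc.2 (zero_le_one (α := ℝ)))
    (right_mem_Icc.2 (zero_le_one (α := ℝ)))
  rwa [hξ.source, hξ.target] at this

/-- A Lipschitz curve in the network, on the time interval `[0, T]`. -/
structure IsLipschitzCurve (Γ : EmbeddedNetwork N ι) (Λ : NNReal) (T : ℝ)
    (ξ : ℝ → EuclideanSpace ℝ (Fin N)) (y x : EuclideanSpace ℝ (Fin N)) : Prop where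
  lipschitzOnWith : LipschitzOnWith Λ ξ (Icc 0 T)
  mapsTo : MapsTo ξ (Icc 0 T) Γ.carrier
  source : ξ 0 = y
  target : ξ T = x

theorem IsLipschitzCurve.isCurve {Λ : NNReal} {T : ℝ} {ξ : ℝ → EuclideanSpace ℝ (Fin N)}
    {y x : EuclideanSpace ℝ (Fin N)} (hT : 0 ≤ T) (h : Γ.IsLipschitzCurve Λ T ξ y x) :
    Γ.IsCurve T ξ y x :=
  ⟨LipschitzOnWith.absolutelyContinuousOnInterval (by
    rw [uIcc_of_le hT]; exact h.lipschitzOnWith), h.mapsTo, h.source, h.target⟩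

theorem IsLipschitzCurve.reverse {Λ : NNReal} {T : ℝ} {ξ : ℝ → EuclideanSpace ℝ (Fin N)}
    {y x : EuclideanSpace ℝ (Fin N)} (h : Γ.IsLipschitzCurve Λ T ξ y x) :
    Γ.IsLipschitzCurve Λ T (fun t => ξ (T - t)) x y := by
  have hmaps : ∀ t ∈ Icc 0 T, T - t ∈ Icc 0 T := fun t ht =>
    ⟨by linarith [ht.2], by linarith [ht.1]⟩
  refine ⟨LipschitzOnWith.of_dist_le_mul fun s hs t ht => ?_, fun t ht => h.mapsTo (hmaps t ht),
    by simp [h.target], by simp [h.source]⟩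
  have := h.lipschitzOnWith.dist_le_mul _ (hmaps s hs) _ (hmaps t ht)
  rwa [dist_sub_left] at this

/-- A curve shorter than `Λ * T` is run at constant speed. The time `θ` is any right inverse of the
rescaled arclength `φ`, possibly discontinuous; the composition is Lipschitz because distances along
the curve are bounded by differences of `φ`. -/
theorem exists_isLipschitzCurve_of_lt {y x : EuclideanSpace ℝ (Fin N)} (hy : y ∈ Γ.carrier)
    (hx : x ∈ Γ.carrier) {Λ : NNReal} {T : ℝ} (hT : 0 < T) (h : Γ.geodesicDist y x < Λ * T) :
    ∃ ξ, Γ.IsLipschitzCurve Λ T ξ y x := by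
  have hΛT : 0 ≤ Λ * T := by positivity
  rw [geodesicDist, ← ENNReal.lt_ofReal_iff_toReal_lt (iInf_eVariationOn_ne_top hy hx)] at h
  simp only [iInf_lt_iff] at h
  obtain ⟨ξ, hξ, hlt⟩ := h
  have hac := hξ.absolutelyContinuous
  have hn := hac.intervalIntegrable_norm_deriv
  set φ : ℝ → ℝ := fun t => ∫ r in (0 : ℝ)..t, ‖deriv ξ r‖
  have h01 : (0 : ℝ) ≤ 1 := zero_le_one
  have hφ0 : φ 0 = 0 := intervalIntegral.integral_same
  have hφ1 : φ 1 ≤ Λ * T := by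
    have := (hac.integral_norm_deriv_le_eVariationOn h01).trans hlt.le
    exact (ENNReal.ofReal_le_ofReal_iff hΛT).1 this
  have hφ1' : 0 ≤ φ 1 := intervalIntegral.integral_nonneg h01 fun t _ => norm_nonneg _
  have hsub : ∀ s ∈ Icc (0 : ℝ) 1, ∀ t ∈ Icc (0 : ℝ) 1, uIcc s t ⊆ uIcc 0 1 := fun s hs t ht => by
    rw [uIcc_of_le h01]; exact uIcc_subset_Icc hs ht
  have h0m : (0 : ℝ) ∈ Icc (0 : ℝ) 1 := left_mem_Icc.2 h01
  have hd : ∀ s ∈ Icc (0 : ℝ) 1, ∀ t ∈ Icc (0 : ℝ) 1, dist (ξ s) (ξ t) ≤ |φ s - φ t| := by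
    have key : ∀ s ∈ Icc (0 : ℝ) 1, ∀ t ∈ Icc (0 : ℝ) 1, s ≤ t → dist (ξ s) (ξ t) ≤ |φ s - φ t| := by
      intro s hs t ht hst
      rw [abs_sub_comm]
      simp only [φ]
      rw [intervalIntegral.integral_interval_sub_left (hn.mono_set (hsub 0 h0m t ht))
        (hn.mono_set (hsub 0 h0m s hs))]
      exact ((hac.mono (hsub s hs t ht)).dist_le_integral hst).trans (le_abs_self _)
    intro s hs t ht
    rcases le_total s t with hst | hst
    · exact key s hs t ht hst
    · rw [dist_comm, abs_sub_comm]; exact key t ht s hs hst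
  have hφc : ContinuousOn φ (Icc 0 1) := by
    have := (hn.absolutelyContinuousOnInterval_intervalIntegral (c := 0) left_mem_uIcc).continuousOn
    rwa [uIcc_of_le h01] at this
  have hex : ∀ u, ∃ t, u ∈ Icc 0 T → t ∈ Icc (0 : ℝ) 1 ∧ φ t = φ 1 / T * u := fun u => by
    by_cases hu : u ∈ Icc 0 T
    · have hmem : φ 1 / T * u ∈ Icc (φ 0) (φ 1) := by
        rw [hφ0]
        refine ⟨mul_nonneg (div_nonneg hφ1' hT.le) hu.1, ?_⟩
        calc φ 1 / T * u ≤ φ 1 / T * T := mul_le_mul_of_nonneg_left hu.2 (div_nonneg hφ1' hT.le)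
          _ = φ 1 := div_mul_cancel₀ _ hT.ne'
      obtain ⟨t, ht, h⟩ := intermediate_value_Icc h01 hφc hmem
      exact ⟨t, fun _ => ⟨ht, h⟩⟩
    · exact ⟨0, fun h => absurd h hu⟩
  choose θ hθ using hex
  have h0T : (0 : ℝ) ∈ Icc 0 T := left_mem_Icc.2 hT.le
  have hTT : T ∈ Icc 0 T := right_mem_Icc.2 hT.le
  refine ⟨fun u => ξ (θ u), LipschitzOnWith.of_dist_le_mul fun u hu v hv => ?_,
    fun u hu => hξ.mapsTo (hθ u hu).1, ?_, ?_⟩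
  · refine (hd _ (hθ u hu).1 _ (hθ v hv).1).trans ?_
    rw [(hθ u hu).2, (hθ v hv).2, ← mul_sub, abs_mul, abs_of_nonneg (div_nonneg hφ1' hT.le),
      Real.dist_eq]
    exact mul_le_mul_of_nonneg_right ((div_le_iff₀ hT).2 hφ1) (abs_nonneg _)
  · rw [← hξ.source, ← dist_le_zero]
    refine (hd _ (hθ 0 h0T).1 0 h0m).trans_eq ?_
    rw [(hθ 0 h0T).2, hφ0]; simp
  · rw [← hξ.target, ← dist_le_zero]
    refine (hd _ (hθ T hTT).1 1 (right_mem_Icc.2 h01)).trans_eq ?_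
    rw [(hθ T hTT).2, div_mul_cancel₀ _ hT.ne']; simp

/-- The extra unit of speed gives a strict inequality, so no shortest curve is required. For `T = 0`
the endpoints coincide. -/
theorem exists_isLipschitzCurve {y x : EuclideanSpace ℝ (Fin N)} (hy : y ∈ Γ.carrier)
    (hx : x ∈ Γ.carrier) {Λ : NNReal} {T : ℝ} (hT : 0 ≤ T) (h : Γ.geodesicDist y x ≤ Λ * T) :
    ∃ ξ, Γ.IsLipschitzCurve (Λ + 1) T ξ y x := by
  rcases hT.eq_or_lt with rfl | hT
  · have : dist y x ≤ 0 := (dist_le_geodesicDist hy hx).trans (by simpa using h)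
    obtain rfl := dist_le_zero.1 this
    exact ⟨fun _ => y, (LipschitzWith.const y).lipschitzOnWith.weaken zero_le, fun _ _ => hy, rfl, rfl⟩
  · refine exists_isLipschitzCurve_of_lt hy hx hT (h.trans_lt ?_)
    rw [NNReal.coe_add, NNReal.coe_one, add_mul, one_mul]
    linarith

namespace Hamiltonian

variable (H : Γ.Hamiltonian) (c : EuclideanSpace ℝ (Fin N) → ℝ)

theorem add_mem_actions {S T : ℝ} {y z x : EuclideanSpace ℝ (Fin N)} (hS : 0 ≤ S) (hT : 0 ≤ T)
    {A B : ℝ} (hA : A ∈ H.actions c y z S) (hB : B ∈ H.actions c z x T) :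
    A + B ∈ H.actions c y x (S + T) := by
  obtain ⟨ξ, hξ, hiξ, rfl⟩ := hA
  obtain ⟨ζ, hζ, hiζ, rfl⟩ := hB
  have h0 : ξ S = ζ 0 := hξ.target.trans hζ.source.symm
  set g : ℝ → ℝ := fun t => H.lagrangian c (concat S ξ ζ t) (deriv (concat S ξ ζ) t)
  have e1 : EqOn (fun t => H.lagrangian c (ξ t) (deriv ξ t)) g (uIoo 0 S) := fun t ht => by
    rw [uIoo_of_le hS] at ht
    simp only [g]
    rw [concat_of_le _ _ ht.2.le, deriv_concat_of_lt _ _ ht.2]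
  have hi2 : IntervalIntegrable (fun t => H.lagrangian c (ζ (t - S)) (deriv ζ (t - S))) volume
      S (S + T) := by
    have := hiζ.comp_sub_right S
    rwa [zero_add, add_comm T] at this
  have e2 : EqOn (fun t => H.lagrangian c (ζ (t - S)) (deriv ζ (t - S))) g (uIoo S (S + T)) :=
    fun t ht => by
      rw [uIoo_of_le (by linarith)] at ht
      simp only [g]
      rw [concat_of_ge h0 ht.1.le, deriv_concat_of_gt h0 ht.1]
  have i1 : IntervalIntegrable g volume 0 S := hiξ.congr_uIoo e1
  have i2 : IntervalIntegrable g volume S (S + T) := hi2.congr_uIoo e2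
  refine ⟨_, hξ.concat hS hT hζ, i1.trans i2, ?_⟩
  rw [← intervalIntegral.integral_add_adjacent_intervals i1 i2,
    ← intervalIntegral.integral_congr_uIoo e1, ← intervalIntegral.integral_congr_uIoo e2,
    intervalIntegral.integral_comp_sub_right (fun t => H.lagrangian c (ζ t) (deriv ζ t)) S, sub_self,
    add_sub_cancel_left]

theorem exists_action_le_of_isLipschitzCurve (Λ : NNReal) : ∃ M, 0 ≤ M ∧ ∀ T ξ y x, 0 ≤ T →
    Γ.IsLipschitzCurve Λ T ξ y x → ∃ A ∈ H.actions c y x T, A ≤ M * T := by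
  obtain ⟨M, hM, hM'⟩ := H.exists_lagrangian_le c Λ
  obtain ⟨M₀, -, hM₀⟩ := H.exists_le_lagrangian c 0
  refine ⟨M, hM, fun T ξ y x hT hξ => ?_⟩
  have hc := hξ.isCurve hT
  obtain ⟨hi, hle⟩ := intervalIntegrable_and_integral_le_of_le_deriv (B := fun t => M * t) (k := 0)
    (M := M₀) hT (fun s _ t _ hst => by
      simpa using mul_le_mul_of_nonneg_left hst hM)
    (H.aemeasurable_lagrangian c hT hc.absolutelyContinuous hc.mapsTo).aestronglyMeasurable (by
      filter_upwards [Γ.ae_isVelocity hc.absolutelyContinuous hc.mapsTo] with t ht htm β hβ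
      have hv := (ht htm).2
      have hβ' : β = M := hβ.unique (by simpa using (hasDerivAt_id t).const_mul M)
      rw [hβ']
      refine ⟨by simpa using hM₀ _ _ hv, hM' _ _ hv ?_⟩
      exact norm_deriv_le_of_lipschitzOn (Icc_mem_nhds htm.1 htm.2) hξ.lipschitzOnWith)
  exact ⟨_, ⟨ξ, hc, hi, rfl⟩, by simpa using hle⟩

/-- A reversed curve has the same Lipschitz constant, so both directions are covered although the
Lagrangian need not be even; symmetry of the geodesic distance is not needed. -/
theorem exists_action_le (Λ : NNReal) : ∃ M, 0 ≤ M ∧ ∀ y ∈ Γ.carrier, ∀ x ∈ Γ.carrier, ∀ T, 0 ≤ T →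
    Γ.geodesicDist y x ≤ Λ * T →
    (∃ A ∈ H.actions c y x T, A ≤ M * T) ∧ ∃ A ∈ H.actions c x y T, A ≤ M * T := by
  obtain ⟨M, hM, hM'⟩ := H.exists_action_le_of_isLipschitzCurve c (Λ + 1)
  refine ⟨M, hM, fun y hy x hx T hT h => ?_⟩
  obtain ⟨ξ, hξ⟩ := exists_isLipschitzCurve hy hx hT h
  exact ⟨hM' T ξ y x hT hξ, hM' T _ x y hT hξ.reverse⟩

end Hamiltonian

end EmbeddedNetwork

/-! ### Time changes and shortening of curves. -/

namespace EmbeddedNetwork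

variable {N : ℕ} {ι : Type*} {Γ : EmbeddedNetwork N ι}

namespace Hamiltonian

variable (H : Γ.Hamiltonian) (c : EuclideanSpace ℝ (Fin N) → ℝ)

/-- A measurable change of speed `w ∈ [1/2, 1]`, equal to `1` at the times when a given curve is
fast, which shortens its time by `τ`. -/
theorem exists_speed {f : ℝ → ℝ} {R T τ : ℝ} (hf : Measurable f) (hf0 : ∀ t, 0 ≤ f t)
    (hfi : IntervalIntegrable f volume 0 T) (hR : 0 < R) (hT : 0 < T)
    (hfR : 2 * ∫ t in (0 : ℝ)..T, f t ≤ R * T) (hτ : 0 ≤ τ) (hτT : 4 * τ ≤ T) :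
    ∃ w : ℝ → ℝ, Measurable w ∧ (∀ t, w t ∈ Icc (1 / 2 : ℝ) 1) ∧ (∀ t, R < f t → w t = 1) ∧
      ∫ t in (0 : ℝ)..T, w t = T - τ := by
  set χ : ℝ → ℝ := {t | f t ≤ R}.indicator 1
  have hχm : Measurable χ := measurable_one.indicator (measurableSet_le hf measurable_const)
  have hχ0 : ∀ t, 0 ≤ χ t := fun t => indicator_nonneg (fun _ _ => zero_le_one) t
  have hχ1 : ∀ t, χ t ≤ 1 := fun t => indicator_le_self' (fun _ _ => zero_le_one) t
  have hχi : IntervalIntegrable χ volume 0 T := by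
    refine (intervalIntegrable_const (c := (1 : ℝ))).mono_fun hχm.aestronglyMeasurable
      (Eventually.of_forall fun t => ?_)
    simp only [Real.norm_eq_abs, abs_of_nonneg (hχ0 t), abs_one]
    exact hχ1 t
  set m := ∫ t in (0 : ℝ)..T, χ t
  -- Chebyshev's inequality: the times with `f ≤ R` fill at least half of `[0, T]`.
  have hm : T / 2 ≤ m := by
    have h1 : ∫ t in (0 : ℝ)..T, (1 - R⁻¹ * f t) ≤ m := by
      refine intervalIntegral.integral_mono_on hT.le
        (intervalIntegrable_const.sub (hfi.const_mul _)) hχi fun t _ => ?_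
      by_cases ht : f t ≤ R
      · have : χ t = 1 := indicator_of_mem (s := {t | f t ≤ R}) ht _
        rw [this]
        linarith [mul_nonneg (inv_nonneg.2 hR.le) (hf0 t)]
      · have : χ t = 0 := indicator_of_notMem (s := {t | f t ≤ R}) ht _
        rw [this, sub_nonpos, ← div_eq_inv_mul, one_le_div hR]
        exact (not_le.1 ht).le
    rw [intervalIntegral.integral_sub intervalIntegrable_const (hfi.const_mul _),
      intervalIntegral.integral_const_mul] at h1
    simp only [intervalIntegral.integral_const, sub_zero, smul_eq_mul, mul_one] at h1
    have h2 : R⁻¹ * ∫ t in (0 : ℝ)..T, f t ≤ T / 2 := by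
      rw [inv_mul_le_iff₀ hR]; linarith
    linarith
  have hm0 : 0 < m := by linarith
  -- Spreading the saved time evenly over the slow times gives `w = 1 - θ` there, and `θ ≤ 1/2`
  -- because `τ ≤ T / 4` and `m ≥ T / 2`.
  set θ := τ / m
  have hθ0 : 0 ≤ θ := div_nonneg hτ hm0.le
  have hθ1 : θ ≤ 1 / 2 := by
    rw [div_le_iff₀ hm0]; linarith
  refine ⟨fun t => 1 - θ * χ t, measurable_const.sub (hχm.const_mul _), fun t => ⟨?_, ?_⟩,
    fun t ht => ?_, ?_⟩
  · have := mul_le_mul hθ1 (hχ1 t) (hχ0 t) (by norm_num)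
    linarith
  · linarith [mul_nonneg hθ0 (hχ0 t)]
  · have : χ t = 0 := indicator_of_notMem (s := {t | f t ≤ R}) (not_le.2 ht) _
    simp [this]
  · rw [intervalIntegral.integral_sub intervalIntegrable_const (hχi.const_mul _),
      intervalIntegral.integral_const_mul, div_mul_cancel₀ _ hm0.ne']
    simp

/-- The inverse of the time change with density `w ∈ [1/2, 1]`. -/
theorem exists_time_change {w : ℝ → ℝ} {T T' : ℝ} (hT : 0 < T) (hw : Measurable w)
    (hw' : ∀ t, w t ∈ Icc (1 / 2 : ℝ) 1) (hT' : ∫ t in (0 : ℝ)..T, w t = T') :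
    ∃ φ : ℝ → ℝ, MapsTo φ (Icc 0 T') (Icc 0 T) ∧ MonotoneOn φ (Icc 0 T') ∧
      LipschitzOnWith 2 φ (Icc 0 T') ∧ φ 0 = 0 ∧ φ T' = T ∧
      ∀ P : ℝ → Prop, (∀ᵐ t, t ∈ Ioo 0 T → P t) →
        ∀ᵐ u, u ∈ Ioo 0 T' → P (φ u) ∧ HasDerivAt φ (w (φ u))⁻¹ u := by
  have hi : ∀ a b, IntervalIntegrable w volume a b := fun a b => by
    refine (intervalIntegrable_const (c := (1 : ℝ))).mono_fun hw.aestronglyMeasurable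
      (Eventually.of_forall fun t => ?_)
    simp only [Real.norm_eq_abs, abs_one]
    exact abs_le.2 ⟨by linarith [(hw' t).1], (hw' t).2⟩
  set σ : ℝ → ℝ := fun t => ∫ r in (0 : ℝ)..t, w r
  have hσ : ∀ s t, σ t - σ s = ∫ r in s..t, w r := fun s t =>
    intervalIntegral.integral_interval_sub_left (hi 0 t) (hi 0 s)
  have hσ1 : ∀ s t, s ≤ t → (t - s) / 2 ≤ σ t - σ s ∧ σ t - σ s ≤ t - s := by
    intro s t hst
    rw [hσ]
    have h1 := intervalIntegral.integral_mono_on hst (intervalIntegrable_const (c := (1 / 2 : ℝ)))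
      (hi s t) fun r _ => (hw' r).1
    have h2 := intervalIntegral.integral_mono_on hst (hi s t)
      (intervalIntegrable_const (c := (1 : ℝ))) fun r _ => (hw' r).2
    simp only [intervalIntegral.integral_const, smul_eq_mul] at h1 h2
    constructor <;> linarith
  have hσ0 : σ 0 = 0 := intervalIntegral.integral_same
  have hσT : σ T = T' := hT'
  have hσlip : LipschitzOnWith 1 σ univ := by
    refine LipschitzOnWith.of_dist_le_mul fun s _ t _ => ?_
    rw [NNReal.coe_one, one_mul, Real.dist_eq, Real.dist_eq]
    rcases le_total s t with h | h
    · rw [abs_sub_comm, abs_sub_comm s, abs_of_nonneg (sub_nonneg.2 h), abs_of_nonneg]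
      · exact (hσ1 s t h).2
      · linarith [(hσ1 s t h).1]
    · rw [abs_of_nonneg (sub_nonneg.2 h), abs_of_nonneg]
      · exact (hσ1 t s h).2
      · linarith [(hσ1 t s h).1]
  have hT'0 : 0 ≤ T' := by
    have := (hσ1 0 T hT.le).1
    rw [hσ0, hσT] at this
    linarith
  have hex : ∀ u, ∃ t, u ∈ Icc 0 T' → t ∈ Icc 0 T ∧ σ t = u := fun u => by
    by_cases hu : u ∈ Icc 0 T'
    · obtain ⟨t, ht, h⟩ := intermediate_value_Icc hT.le
        (hσlip.continuousOn.mono (subset_univ _)) (by rwa [hσ0, hσT])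
      exact ⟨t, fun _ => ⟨ht, h⟩⟩
    · exact ⟨0, fun h => absurd h hu⟩
  choose φ hφ using hex
  have hle : ∀ s t, σ s ≤ σ t → s ≤ t := fun s t h => by
    by_contra hcon
    push Not at hcon
    linarith [(hσ1 t s hcon.le).1]
  have hinj : ∀ s t, σ s = σ t → s = t := fun s t h => le_antisymm (hle _ _ h.le) (hle _ _ h.ge)
  have h0 : (0 : ℝ) ∈ Icc 0 T' := left_mem_Icc.2 hT'0
  have h1 : T' ∈ Icc 0 T' := right_mem_Icc.2 hT'0
  have hmono : MonotoneOn φ (Icc 0 T') := fun u hu v hv huv =>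
    hle _ _ (by rwa [(hφ u hu).2, (hφ v hv).2])
  have hφlip : LipschitzOnWith 2 φ (Icc 0 T') := by
    have key : ∀ u ∈ Icc 0 T', ∀ v ∈ Icc 0 T', u ≤ v → dist (φ u) (φ v) ≤ 2 * dist u v := by
      intro u hu v hv huv
      have h2 := (hσ1 _ _ (hmono hu hv huv)).1
      rw [(hφ u hu).2, (hφ v hv).2] at h2
      rw [dist_comm, dist_comm u, Real.dist_eq, Real.dist_eq, abs_of_nonneg (sub_nonneg.2 huv),
        abs_of_nonneg (sub_nonneg.2 (hmono hu hv huv))]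
      linarith
    refine LipschitzOnWith.of_dist_le_mul fun u hu v hv => ?_
    rcases le_total u v with h | h
    · exact key u hu v hv h
    · rw [dist_comm, dist_comm u]; exact key v hv u hu h
  refine ⟨φ, fun u hu => (hφ u hu).1, hmono, hφlip, hinj _ _ ?_, hinj _ _ ?_, fun P hP => ?_⟩
  · rw [(hφ 0 h0).2, hσ0]
  · rw [(hφ T' h1).2, hσT]
  · have hd : ∀ᵐ t, t ∈ Ioo 0 T → P t ∧ HasDerivAt σ (w t) t := by
      filter_upwards [hP, (hi 0 T).ae_hasDerivAt_integral] with t h2 h3 ht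
      exact ⟨h2 ht, h3 (Icc_subset_uIcc (Ioo_subset_Icc_self ht)) 0 left_mem_uIcc⟩
    -- The exceptional old times are null, and the Lipschitz map `σ` sends them to a null set of new
    -- times; this makes a.e. properties transfer to `φ u`.
    have hnull := (hσlip.mono (subset_univ _)).volume_image_eq_zero (ae_iff.1 hd)
    filter_upwards [measure_eq_zero_iff_ae_notMem.1 hnull] with u hu huT
    have huI := Ioo_subset_Icc_self huT
    obtain ⟨h2, h3⟩ := hφ u huI
    have hu0 : φ u ∈ Ioo 0 T := by
      refine ⟨lt_of_le_of_ne h2.1 fun h => ?_, lt_of_le_of_ne h2.2 fun h => ?_⟩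
      · rw [← h, hσ0] at h3; exact huT.1.ne h3
      · rw [h, hσT] at h3; exact huT.2.ne' h3
    have hgood : P (φ u) ∧ HasDerivAt σ (w (φ u)) (φ u) := by
      by_contra hcon
      exact hu ⟨φ u, fun h => hcon (h hu0), h3⟩
    refine ⟨hgood.1, HasDerivAt.of_local_left_inverse ?_ hgood.2 ?_ ?_⟩
    · exact hφlip.continuousOn.continuousAt (Icc_mem_nhds huT.1 huT.2)
    · linarith [(hw' (φ u)).1]
    · filter_upwards [Icc_mem_nhds huT.1 huT.2] with v hv using (hφ v hv).2

/-- A curve of controlled action can be run in a shorter time, at a cost proportional to the time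
saved. -/
theorem exists_action_sub_le (C : ℝ) (hC : 0 ≤ C) : ∃ K, 0 ≤ K ∧ ∀ y x T τ A, 0 ≤ τ → 4 * τ ≤ T →
    A ∈ H.actions c y x T → A ≤ C * T → ∃ A' ∈ H.actions c y x (T - τ), A' ≤ A + K * τ := by
  obtain ⟨M, hM, hM'⟩ := H.exists_le_lagrangian c 1
  -- Coercivity with slope `1` bounds the length of the curve by `(C + M) * T`, so this `R` meets
  -- the requirement of `exists_speed`.
  set R := 2 * (C + M) + 1
  have hR : 0 < R := by positivity
  obtain ⟨K, hK, hK'⟩ := H.exists_mul_lagrangian_inv_smul_le c R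
  refine ⟨K, hK, fun y x T τ A hτ hτT hA hAC => ?_⟩
  rcases hτ.eq_or_lt with rfl | hτ
  · exact ⟨A, by rwa [sub_zero], by linarith⟩
  have hT : 0 < T := by linarith
  obtain ⟨ξ, hξ, hi, rfl⟩ := hA
  have hac := hξ.absolutelyContinuous
  have hlow : ∀ z q, Γ.IsVelocity z q → -M ≤ H.lagrangian c z q := fun z q h => by
    linarith [hM' z q h, norm_nonneg q]
  set g : ℝ → ℝ := fun t => H.lagrangian c (ξ t) (deriv ξ t) with hg
  have hn := (H.mul_dist_le_action c zero_le_one hM' hT.le hac hξ.mapsTo hi).1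
  obtain ⟨w, hwm, hw, hwR, hwT⟩ := exists_speed (measurable_deriv ξ).norm (fun t => norm_nonneg _)
    hac.intervalIntegrable_norm_deriv hR hT (by
      have : R * T = 2 * (C + M) * T + T := by simp only [R]; ring
      linarith) hτ.le hτT
  obtain ⟨φ, hφm, hφmono, hφlip, hφ0, hφT, hφae⟩ := exists_time_change hT hwm hw hwT
  set T' := T - τ
  have hT' : 0 ≤ T' := by simp only [T']; linarith
  have hcurve : Γ.IsCurve T' (fun u => ξ (φ u)) y x := by
    refine ⟨hac.comp_monotoneOn ?_ ?_ ?_, fun u hu => hξ.mapsTo (hφm hu), ?_, ?_⟩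
    · rwa [uIcc_of_le hT']
    · rwa [uIcc_of_le hT', uIcc_of_le hT.le]
    · exact LipschitzOnWith.absolutelyContinuousOnInterval (by rwa [uIcc_of_le hT'])
    · rw [hφ0, hξ.source]
    · rw [hφT, hξ.target]
  set I : ℝ → ℝ := fun t => ∫ r in (0 : ℝ)..t, g r
  have hIinc : ∀ s ∈ Icc 0 T, ∀ t ∈ Icc 0 T, s ≤ t → -(M * (t - s)) ≤ I t - I s := by
    intro s hs t ht hst
    have hsub : ∀ a ∈ Icc 0 T, ∀ b ∈ Icc 0 T, IntervalIntegrable g volume a b := fun a ha b hb =>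
      hi.mono_set (by rw [uIcc_of_le hT.le]; exact uIcc_subset_Icc ha hb)
    have h0 : (0 : ℝ) ∈ Icc 0 T := left_mem_Icc.2 hT.le
    obtain ⟨h1, h2⟩ := isCurve_sub hξ hs ht
    have h3 := (H.mul_dist_le_action c zero_le_one hM' hst h1 h2 (hsub s hs t ht)).2
    simp only [I]
    rw [intervalIntegral.integral_interval_sub_left (hsub 0 h0 t ht) (hsub 0 h0 s hs)]
    have : 0 ≤ 1 * dist (ξ s) (ξ t) := by positivity
    linarith
  -- As `φ` is 2-Lipschitz, `I ∘ φ` decreases at rate at most `2 * M`, and `K * (φ u - u)` at rate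
  -- at most `K`. The latter term grows by `K * (T - T') = K * τ` in total, which is the cost of
  -- shortening.
  have hB : MonotoneOn (fun u => I (φ u) + K * (φ u - u) + (2 * M + K) * u) (Icc 0 T') := by
    intro u hu v hv huv
    have h1 := hφmono hu hv huv
    have h2 := hIinc _ (hφm hu) _ (hφm hv) h1
    have h3 : φ v - φ u ≤ 2 * (v - u) := by
      have := hφlip.dist_le_mul v hv u hu
      rw [Real.dist_eq, Real.dist_eq, abs_of_nonneg (sub_nonneg.2 h1),
        abs_of_nonneg (sub_nonneg.2 huv)] at this
      exact this
    have h4 := mul_le_mul_of_nonneg_left h3 hM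
    have h5 := mul_le_mul_of_nonneg_left h1 hK
    simp only
    linarith
  obtain ⟨hint, hle⟩ := intervalIntegrable_and_integral_le_of_le_deriv
    (B := fun u => I (φ u) + K * (φ u - u)) (M := M) hT' hB
    (H.aemeasurable_lagrangian c hT' hcurve.absolutelyContinuous
      hcurve.mapsTo).aestronglyMeasurable (by
      filter_upwards [hφae (fun t => (HasDerivAt ξ (deriv ξ t) t ∧ Γ.IsVelocity (ξ t) (deriv ξ t)) ∧
        HasDerivAt I (g t) t) (by
          filter_upwards [Γ.ae_isVelocity hac hξ.mapsTo, hi.ae_hasDerivAt_integral] with t h1 h2 ht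
          exact ⟨h1 ht, h2 (Icc_subset_uIcc (Ioo_subset_Icc_self ht)) 0 left_mem_uIcc⟩)]
        with u hu huT β hβ
      obtain ⟨⟨⟨hd, hv⟩, hI⟩, hφd⟩ := hu huT
      have hwu := hw (φ u)
      have hw0 : 0 < w (φ u) := by linarith [hwu.1]
      have hη : deriv (fun u => ξ (φ u)) u = (w (φ u))⁻¹ • deriv ξ (φ u) :=
        (hd.scomp u hφd).deriv
      have hβ' : β = g (φ u) * (w (φ u))⁻¹ + K * ((w (φ u))⁻¹ - 1) :=
        hβ.unique ((hI.comp u hφd).add ((hφd.sub (hasDerivAt_id u)).const_mul K))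
      rw [hη]
      refine ⟨hlow _ _ (hv.smul _), ?_⟩
      have hkey : w (φ u) * H.lagrangian c (ξ (φ u)) ((w (φ u))⁻¹ • deriv ξ (φ u)) ≤
          g (φ u) + K * (1 - w (φ u)) := by
        -- Slow times use the convexity estimate; at fast times `w = 1` and nothing changes.
        rcases le_or_gt ‖deriv ξ (φ u)‖ R with h | h
        · exact hK' _ _ hv h _ hwu
        · rw [hwR _ h]; simp [hg]
      rw [hβ', ← mul_le_mul_iff_right₀ hw0]
      refine hkey.trans_eq ?_
      field_simp)
  refine ⟨_, ⟨_, hcurve, hint, rfl⟩, hle.trans_eq ?_⟩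
  have hI0 : I 0 = 0 := intervalIntegral.integral_same
  simp only [hφ0, hφT, hI0, T', I]
  ring

end Hamiltonian

end EmbeddedNetwork

/-! ### Proof of the proposition. -/

theorem mainTheorem8 {N : ℕ} {ι : Type*} (Γ : EmbeddedNetwork N ι) (H : Γ.Hamiltonian)
    (c : EuclideanSpace ℝ (Fin N) → ℝ) (hc : H.IsFluxLimiter c) (C : ℝ) (hC : 0 < C) :
    (∀ y x : EuclideanSpace ℝ (Fin N), ∀ T : ℝ, (y, x, T) ∈ Γ.reachable C →
      IsLeast (H.actions c y x T) (H.minAction c y x T)) ∧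
    ∃ ℓ : ℝ, ∀ y x y' x' : EuclideanSpace ℝ (Fin N), ∀ T T' : ℝ,
      (y, x, T) ∈ Γ.reachable C → (y', x', T') ∈ Γ.reachable C →
      |H.minAction c y x T - H.minAction c y' x' T'| ≤
        ℓ * (Γ.geodesicDist y y' + Γ.geodesicDist x x' + |T - T'|) := by
  obtain ⟨M₀, hM₀, hlow⟩ := H.exists_le_of_mem_actions c
  obtain ⟨M₁, hM₁, hup⟩ := H.exists_action_le c C.toNNReal
  obtain ⟨M₂, hM₂, hup'⟩ := H.exists_action_le c 1
  obtain ⟨K, hK, hshort⟩ := H.exists_action_sub_le c M₁ hM₁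
  have hle : ∀ y x T, (y, x, T) ∈ Γ.reachable C → ∃ A ∈ H.actions c y x T, A ≤ M₁ * T := by
    rintro y x T ⟨hy, hx, hT, hd⟩
    exact (hup y hy x hx T hT (by rwa [Real.coe_toNNReal _ hC.le])).1
  have hleast : ∀ y x T, (y, x, T) ∈ Γ.reachable C →
      IsLeast (H.actions c y x T) (H.minAction c y x T) := by
    intro y x T h
    obtain ⟨A, hA, -⟩ := hle y x T h
    exact H.isLeast_minAction hc h.2.2.1 ⟨A, hA⟩
  have hminle : ∀ y x T, (y, x, T) ∈ Γ.reachable C → H.minAction c y x T ≤ M₁ * T := by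
    intro y x T h
    obtain ⟨A, hA, hA'⟩ := hle y x T h
    exact ((hleast y x T h).2 hA).trans hA'
  -- One-sided estimate, applied twice with the roles exchanged. The constant adds the costs of both
  -- cases: `9 * M₁ + 8 * M₀` for short times, `2 * K + 3 * M₂` for shortening and connecting.
  have key : ∀ y x T y' x' T' d₁ d₂, (y, x, T) ∈ Γ.reachable C → (y', x', T') ∈ Γ.reachable C →
      0 ≤ d₁ → 0 ≤ d₂ → (∀ t, d₁ ≤ t → ∃ A ∈ H.actions c y' y t, A ≤ M₂ * t) →
      (∀ t, d₂ ≤ t → ∃ A ∈ H.actions c x x' t, A ≤ M₂ * t) →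
      H.minAction c y' x' T' ≤ H.minAction c y x T +
        (9 * M₁ + 8 * M₀ + 2 * K + 3 * M₂) * (d₁ + d₂ + |T - T'|) := by
    intro y x T y' x' T' d₁ d₂ h h' hd₁ hd₂ h₁ h₂
    set δ := d₁ + d₂ + |T - T'| with hδ
    obtain ⟨hTT, hTT'⟩ := abs_le.1 (le_refl |T - T'|)
    have habs := abs_nonneg (T - T')
    have hδ0 : 0 ≤ δ := by positivity
    have e₀ := mul_nonneg hM₀ hδ0
    have e₁ := mul_nonneg hM₁ hδ0
    have e₂ := mul_nonneg hM₂ hδ0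
    have e₃ := mul_nonneg hK hδ0
    have hT : 0 ≤ T := h.2.2.1
    -- Shortening by `2 * δ` requires `4 * (2 * δ) ≤ T`, whence the threshold.
    rcases le_or_gt T (8 * δ) with hcase | hcase
    · have f₁ := hminle _ _ _ h'
      have f₂ := hlow y x T hT _ (hleast _ _ _ h).1
      have f₃ := mul_le_mul_of_nonneg_left hcase hM₀
      have f₄ := mul_le_mul_of_nonneg_left (show T' ≤ 9 * δ by linarith) hM₁
      linarith
    · obtain ⟨A, hA, hA'⟩ := hshort y x T (2 * δ) _ (by linarith) (by linarith)
        (hleast _ _ _ h).1 (hminle _ _ _ h)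
      obtain ⟨A₁, hA₁, hA₁'⟩ := h₁ d₁ le_rfl
      -- The last piece takes all the remaining time, so the total is exactly `T'`; the saved `2 *
      -- δ` leaves it at least `d₂`, as needed to reach `x'`.
      obtain ⟨A₂, hA₂, hA₂'⟩ := h₂ (T' - (T - 2 * δ) - d₁) (by linarith)
      have hmem := H.add_mem_actions c (by linarith) (by linarith)
        (H.add_mem_actions c hd₁ (by linarith) hA₁ hA) hA₂
      rw [show d₁ + (T - 2 * δ) + (T' - (T - 2 * δ) - d₁) = T' by ring] at hmem
      have f₁ := (hleast _ _ _ h').2 hmem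
      have f₂ := mul_le_mul_of_nonneg_left (show T' - (T - 2 * δ) ≤ 3 * δ by linarith) hM₂
      linarith
  refine ⟨hleast, 9 * M₁ + 8 * M₀ + 2 * K + 3 * M₂, fun y x y' x' T T' h h' => ?_⟩
  have hy := fun t (ht : Γ.geodesicDist y y' ≤ t) => hup' y h.1 y' h'.1 t
    ((EmbeddedNetwork.geodesicDist_nonneg y y').trans ht) (by simpa using ht)
  have hx := fun t (ht : Γ.geodesicDist x x' ≤ t) => hup' x h.2.1 x' h'.2.1 t
    ((EmbeddedNetwork.geodesicDist_nonneg x x').trans ht) (by simpa using ht)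
  have k₁ := key y x T y' x' T' _ _ h h' (EmbeddedNetwork.geodesicDist_nonneg y y')
    (EmbeddedNetwork.geodesicDist_nonneg x x')
    (fun t ht => (hy t ht).2) fun t ht => (hx t ht).1
  have k₂ := key y' x' T' y x T _ _ h' h (EmbeddedNetwork.geodesicDist_nonneg y y')
    (EmbeddedNetwork.geodesicDist_nonneg x x')
    (fun t ht => (hy t ht).1) fun t ht => (hx t ht).2
  rw [abs_sub_comm T' T] at k₂
  exact abs_le.2 ⟨by linarith, by linarith⟩
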